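/- **Setting.** $[n]=\{0,\dots,n-1\}$, $\oplus$ is bit-wise exclusive-or and $\lg=\log_2$. The universe is $U=[u]$ and the range is $R=[2^b]$, identified with the $b$-bit strings. A random function $H:U\to R$ is *$k$-independent* if for any distinct $x_1,\dots,x_k\in U$ the values $H(x_1),\dots,H(x_k)$ are independent, and $H(x)$ is uniform in $R$ for every $x\in U$. *Simple tabulation* with character tables $h_0,\dots,h_{n-1}:\Phi\to\Psi^d$ is the map $\Phi^n\to\Psi^d$, $x\mapsto\bigoplus_{i\in[n]}h_i(x_i)$, where $\Phi,\Psi$ are sets of bit strings. **Recursive tabulation** with parameter $c$. Let $\ell=\lceil\lg c\rceil+1$, $c'=2^\ell$, $s=\lceil(\lg u)/c'\rceil$ and let $\Phi$ be the set of $s$-bit strings. For $0\le m\le\ell$ let $U_m=\Phi^{2^m}$, the set of bit strings of length $2^ms$; $U=[u]$ is regarded as a subset of $U_\ell$ by binary representation. The *universal part* consists of one simple tabulation function $h_{(m)}:U_m=\Phi^{2^m}\to U_{m-1}^{\,12\cdot 2^m}$ for each $m=1,\dots,\ell$. A recursive hash function $U_0=\Phi\to R$ is a table. For $m\geq 1$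 a recursive hash function on $U_m$ is $x\mapsto\bigoplus_{j}g_j(h_{(m)}(x)_j)$, with $j$ ranging over the $12\cdot 2^m$ output positions and each $g_j$ a recursive hash function on $U_{m-1}$; all $g_j$ use the same $h_{(m-1)},\dots,h_{(1)}$, but each has bottom tables of its own. Thus a hash function $U\to R$ is given by the universal part and $D=\prod_{m=1}^{\ell}12\cdot2^m$ bottom tables $\Phi\to R$. All entries of the tables of the universal part and of the bottom tables are independent and uniformly random. **Model.** Word RAM with word length $w$, where $u\le 2^w$ and $b\le w$ (each key and each hash value fits in a word), and the usual unit-cost operations on words. A representation of the hash function is stored in memory in advance; its preprocessing is not charged. The query program, which is one fixed program for all parameters, computes the hash value of a given key and leaves the representation intact. Space is the number of memory words used, for the representation and by the query; time is the number of steps of a query. **Theorem.** There are an absolute constant $\kappa>0$ and a query program such that the following holds, asymptotically as $c\to\infty$ and $u\to\infty$ with $c^{\,c^2}=u^{o(1)}$, for all $b$ and $w$ as above. With probability $1-o(1/u^{1/c})$ over the choice of the universal part, recursive tabulation with this universal part and random bottom tables is $k$-independent from $U$ to $R$ for every integer $k\le u^{\kappa/c}$ (so it is $u^{\Omega(1/c)}$-independent).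 Moreover, for all choices of the tables, the program evaluates the hash function using space $o(u^{1/c})$ and time $o(c^{\lg c})$. -/

import Mathlib

open Filter Topology Asymptotics MeasureTheory ProbabilityTheory

namespace RecTab

/-! ### Random hash functions -/

/-- Bit strings carry the discrete σ-algebra. -/
instance instMeasurableSpaceBitVec (n : ℕ) : MeasurableSpace (BitVec n) := ⊤

/-- A random function `H ω : K → V` (`ω` distributed according to `μ`) is `k`-independent if
the hash values of any `k` distinct keys are independent random variables, and the hash value
of every fixed key is uniformly distributed in `V`. -/
def KIndependent {Ω K V : Type} [MeasurableSpace Ω] [MeasurableSpace V] [Fintype V]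
    (μ : Measure Ω) (k : ℕ) (H : Ω → K → V) : Prop :=
  (∀ x : Fin k → K, Function.Injective x →
      iIndepFun (fun (i : Fin k) (ω : Ω) => H ω (x i)) μ) ∧
    ∀ (x : K) (v : V), μ {ω | H ω x = v} = ((Fintype.card V : ℕ) : ENNReal)⁻¹

/-! ### Simple tabulation and recursive tabulation -/

/-- The bit-wise exclusive-or `⨁_{i ∈ [n]} f i`. -/
def xorSum {n b : ℕ} (f : Fin n → BitVec b) : BitVec b :=
  (Finset.univ : Finset (Fin n)).fold (fun x y => x ^^^ y) 0 f

/-- Character `i` of a key that consists of `n` characters of `s` bits each. -/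
def charAt {n s : ℕ} (x : BitVec (n * s)) (i : Fin n) : BitVec s :=
  x.extractLsb' (i * s) s

/-- The character tables of a simple tabulation function `Φ^n → Ψ^d`, where `Φ` is the set of
`s`-bit strings and `Ψ` the set of `t`-bit strings. -/
abbrev Tables (n s d t : ℕ) : Type := Fin n → BitVec s → Fin d → BitVec t

/-- Simple tabulation: output character `j` is the xor over `i ∈ [n]` of the `j`-th output
character stored in table `i` for the input character `x_i`. -/
def simpleTab {n s d t : ℕ} (h : Tables n s d t) (x : BitVec (n * s)) : Fin d → BitVec t :=
  fun j => xorSum fun i => h i (charAt x i) j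

/-- Levels are numbered from the bottom. On level `m + 1` a key has `2 ^ (m + 1)` characters of
`s` bits. The simple tabulation function of this level maps it to `12 * 2 ^ (m + 1)` output
characters, each of which is a key of level `m`, that is, has half as many bits. -/
abbrev LevelTables (s m : ℕ) : Type :=
  Tables (2 ^ (m + 1)) s (12 * 2 ^ (m + 1)) (2 ^ m * s)

/-- The universal tables of a recursion of depth `ℓ`: one simple tabulation function for each
level. -/
abbrev UniversalTables (s ℓ : ℕ) : Type := (m : Fin ℓ) → LevelTables s m

/-- The positions of the output characters on the bottom of a recursion of depth `ℓ`;
there are `∏_{1 ≤ m ≤ ℓ} 12 * 2 ^ m` of them. -/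
def Leaf : ℕ → Type
  | 0 => Unit
  | m + 1 => Fin (12 * 2 ^ (m + 1)) × Leaf m

/-- The character tables `Φ → R` on the bottom level, one for each output position;
`R` is the set of `b`-bit strings. -/
abbrev LeafTables (s b ℓ : ℕ) : Type := Leaf ℓ → BitVec s → BitVec b

/-- Recursive tabulation: apply the universal simple tabulation function of the current level,
hash each output character `j` recursively (with the same universal functions on the lower
levels, but with bottom tables of its own), and take the xor of the results. -/
def recHash {s b : ℕ} :
    (ℓ : ℕ) → UniversalTables s ℓ → LeafTables s b ℓ → BitVec (2 ^ ℓ * s) → BitVec b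
  | 0, _, r, x => r () (charAt x ⟨0, Nat.one_pos⟩)
  | m + 1, h, r, x =>
      xorSum fun j => recHash m (fun i => h i.castSucc) (fun p => r (j, p))
        (simpleTab (h (Fin.last m)) x j)

/-- The recursion depth `⌈lg c⌉ + 1`. -/
def depth (c : ℕ) : ℕ := Nat.clog 2 c + 1

/-- The number `⌈lg u / c'⌉` of bits of an input character, where `c' = 2 ^ depth c` is the
number of input characters of a key from `[u]`. -/
def charBits (u c : ℕ) : ℕ := Nat.clog 2 u ⌈/⌉ 2 ^ depth c

/-- The hash function `[u] → [2 ^ b]` given by recursive tabulation with the universal tables `h`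
and the bottom tables `r`. A key is viewed as a string of `c' * charBits u c ≥ lg u` bits. -/
def tabHash {u c b : ℕ} (h : UniversalTables (charBits u c) (depth c))
    (r : LeafTables (charBits u c) b (depth c)) (x : Fin u) : BitVec b :=
  recHash (depth c) h r (BitVec.ofNat (2 ^ depth c * charBits u c) x)

/-- The uniform distribution: all tables are filled with independent random characters. -/
noncomputable def unif (Ω : Type) [MeasurableSpace Ω] : Measure Ω := uniformOn Set.univ

/-- For these universal tables, the family of hash functions given by random bottom tables is
`k`-independent. -/
def Good {u c : ℕ} (b k : ℕ) (h : UniversalTables (charBits u c) (depth c)) : Prop :=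
  KIndependent (unif (LeafTables (charBits u c) b (depth c))) k (fun r => tabHash h r)

/-! ### The word RAM

Programs in a fragment of C. The word length `w` is a parameter of the execution, not of the
program. Time is the number of operations executed, and the memory has `S` cells, each holding
a word; an access to any other cell is an error. -/

/-- The binary operations on words (unsigned arithmetic modulo `2 ^ w`). -/
inductive Op
  | add | sub | mul | div | mod | and | or | xor | shl | shr | lt | eq

def Op.eval {w : ℕ} : Op → BitVec w → BitVec w → BitVec w
  | .add, a, b => a + b
  | .sub, a, b => a - b
  | .mul, a, b => a * b
  | .div, a, b => a / b
  | .mod, a, b => a % b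
  | .and, a, b => a &&& b
  | .or, a, b => a ||| b
  | .xor, a, b => a ^^^ b
  | .shl, a, b => a <<< b
  | .shr, a, b => a >>> b
  | .lt, a, b => if a < b then 1 else 0
  | .eq, a, b => if a = b then 1 else 0

/-- Expressions: numerals, registers (local variables), memory reads, binary operations. -/
inductive Expr
  | lit (n : ℕ)
  | reg (i : ℕ)
  | load (addr : Expr)
  | bin (o : Op) (e₁ e₂ : Expr)

/-- Commands. -/
inductive Cmd
  | skip
  | assign (i : ℕ) (e : Expr)
  | store (addr e : Expr)
  | seq (p q : Cmd)
  | cond (e : Expr) (p q : Cmd)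
  | loop (e : Expr) (p : Cmd)

/-- The state of a machine with word length `w`. -/
structure State (w : ℕ) where
  reg : ℕ → BitVec w
  mem : ℕ → BitVec w

/-- The number of operations needed to evaluate an expression. -/
def Expr.cost : Expr → ℕ
  | .lit _ => 1
  | .reg _ => 1
  | .load e => e.cost + 1
  | .bin _ e₁ e₂ => e₁.cost + e₂.cost + 1

/-- The value of an expression; `none` if it reads outside the `S` memory cells. -/
def Expr.eval {w : ℕ} (S : ℕ) (σ : State w) : Expr → Option (BitVec w)
  | .lit n => some (BitVec.ofNat w n)
  | .reg i => some (σ.reg i)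
  | .load e => (e.eval S σ).bind fun a => if a.toNat < S then some (σ.mem a.toNat) else none
  | .bin o e₁ e₂ => (e₁.eval S σ).bind fun a => (e₂.eval S σ).bind fun b => some (o.eval a b)

/-- `Exec S p σ t σ'`: on a machine with `S` memory cells, the program `p` started in the
state `σ` terminates without error in the state `σ'` after exactly `t` steps. -/
inductive Exec {w : ℕ} (S : ℕ) : Cmd → State w → ℕ → State w → Prop
  | skip (σ : State w) : Exec S .skip σ 1 σ
  | assign {σ : State w} {i : ℕ} {e : Expr} {v : BitVec w} (he : e.eval S σ = some v) :
      Exec S (.assign i e) σ (e.cost + 1) { σ with reg := Function.update σ.reg i v }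
  | store {σ : State w} {addr e : Expr} {a v : BitVec w} (ha : addr.eval S σ = some a)
      (hS : a.toNat < S) (he : e.eval S σ = some v) :
      Exec S (.store addr e) σ (addr.cost + e.cost + 1)
        { σ with mem := Function.update σ.mem a.toNat v }
  | seq {σ σ₁ σ₂ : State w} {p q : Cmd} {t₁ t₂ : ℕ} (hp : Exec S p σ t₁ σ₁)
      (hq : Exec S q σ₁ t₂ σ₂) : Exec S (.seq p q) σ (t₁ + t₂) σ₂
  | cond_true {σ σ₁ : State w} {e : Expr} {p q : Cmd} {v : BitVec w} {t : ℕ}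
      (he : e.eval S σ = some v) (hv : v ≠ 0) (hp : Exec S p σ t σ₁) :
      Exec S (.cond e p q) σ (e.cost + t + 1) σ₁
  | cond_false {σ σ₁ : State w} {e : Expr} {p q : Cmd} {v : BitVec w} {t : ℕ}
      (he : e.eval S σ = some v) (hv : v = 0) (hq : Exec S q σ t σ₁) :
      Exec S (.cond e p q) σ (e.cost + t + 1) σ₁
  | loop_true {σ σ₁ σ₂ : State w} {e : Expr} {p : Cmd} {v : BitVec w} {t₁ t₂ : ℕ}
      (he : e.eval S σ = some v) (hv : v ≠ 0) (hp : Exec S p σ t₁ σ₁)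
      (hl : Exec S (.loop e p) σ₁ t₂ σ₂) :
      Exec S (.loop e p) σ (e.cost + t₁ + t₂ + 1) σ₂
  | loop_false {σ : State w} {e : Expr} {p : Cmd} {v : BitVec w}
      (he : e.eval S σ = some v) (hv : v = 0) :
      Exec S (.loop e p) σ (e.cost + 1) σ

/-- The query program `P` evaluates `f : [u] → [2 ^ b]` on machines with word length `w`, in
space `S` and time `T`: there is a representation of `f`, stored in the first `L ≤ S` memory
cells, such that for every key `x`, given in register `0`, the program terminates within `T`
steps with `f x` in register `0`. It uses no more than `S` memory cells, assumes nothing about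
the initial contents of the other registers and of the other memory cells, and leaves the
representation intact. -/
def Evaluates (P : Cmd) (w S T : ℕ) {u b : ℕ} (f : Fin u → BitVec b) : Prop :=
  ∃ (L : ℕ) (rep : ℕ → BitVec w), L ≤ S ∧
    ∀ (x : Fin u) (σ : State w), σ.reg 0 = BitVec.ofNat w x → (∀ a < L, σ.mem a = rep a) →
      ∃ (t : ℕ) (σ' : State w), Exec S P σ t σ' ∧ t ≤ T ∧
        σ'.reg 0 = (f x).setWidth w ∧ ∀ a < L, σ'.mem a = rep a

end RecTab

open RecTab

/-! For a fixed universal part the hash values depend linearly over GF(2) on the bottom tables. The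
values of given keys are therefore independent and uniform as soon as they can be prescribed
arbitrarily (`card_fiber_mul`). This is possible by peeling (`exists_leafTables`) if on every level
each nonempty set of at most `K` keys contains a key with an output character that no other key of
the set shares: treat the other keys first, then correct this key through that character alone.

A random level rarely lacks this property. If it fails for a set, `exists_spread` finds a subset and
an input position `p` with the largest number `a` of characters, such that for each of these
characters some key with it collides in 12 output positions with keys that differ from it in `p`.
Such a `Witness` consists of `12 * a` equations between table entries. Ordering the characters of
`p` upwards or downwards makes at least `6 * a` of them triangular, so a witness holds with
probability at most `2 ^ (-6at) = 2 ^ (-3nsa)`. This beats the number of witnesses, which is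
dominated by the `2 ^ (nsa)` choices of characters when `K ≤ 2 ^ (s / 26)` (`failureBound_le`); a
union bound over `a`, the witnesses and the levels finishes the probabilistic part.

For the query, the recursion is unrolled into an exclusive-or over numbered leaves
(`recHash_eq_xorSum`), and the program follows the path to each leaf anew. The cost is about `∏ 12 *
2 ^ m`, roughly `c ^ (lg c / 2)`, which leaves room in the time bound; since `c' ≥ 2c`, a table has
about `u ^ (1 / (2c))` entries, which leaves room in the space bound. -/

namespace RecTab

/-! ### Bit strings as a group under exclusive-or -/

/-- Bit strings of length `b`, written additively, with exclusive-or as addition. -/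
def XorVec (b : ℕ) : Type := BitVec b

instance (b : ℕ) : Add (XorVec b) := ⟨fun x y => BitVec.xor x y⟩

instance (b : ℕ) : Zero (XorVec b) := ⟨(0#b : BitVec b)⟩

instance (b : ℕ) : Neg (XorVec b) := ⟨fun x => x⟩

instance (b : ℕ) : AddCommGroup (XorVec b) where
  add_assoc := BitVec.xor_assoc
  zero_add _ := BitVec.zero_xor
  add_zero _ := BitVec.xor_zero
  neg_add_cancel _ := BitVec.xor_self
  add_comm := BitVec.xor_comm
  nsmul := nsmulRec
  zsmul := zsmulRec

/-- By unfolding, `xorSum` is a `Finset.sum` in `XorVec b`, so lemmas on sums in commutative groups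
apply as they stand. -/
theorem xorSum_xor {n b : ℕ} (f g : Fin n → BitVec b) :
    xorSum (fun i => f i ^^^ g i) = xorSum f ^^^ xorSum g :=
  Finset.sum_add_distrib (M := XorVec b) (f := f) (g := g)

theorem xorSum_eq_single {n b : ℕ} (f : Fin n → BitVec b) (j : Fin n)
    (hf : ∀ i, i ≠ j → f i = 0#b) : xorSum f = f j :=
  Finset.sum_eq_single (M := XorVec b) j (fun i _ hi => hf i hi)
    fun h => absurd (Finset.mem_univ j) h

theorem xorSum_succ {n b : ℕ} (f : Fin (n + 1) → BitVec b) :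
    xorSum f = xorSum (fun i : Fin n => f i.castSucc) ^^^ f (Fin.last n) :=
  Fin.sum_univ_castSucc (M := XorVec b) f

theorem xor_xor_self_left {b : ℕ} (x y : BitVec b) : x ^^^ (x ^^^ y) = y := by
  rw [← BitVec.xor_assoc, BitVec.xor_self, BitVec.zero_xor]

/-! ### Characters of keys -/

theorem charAt_toNat {n s : ℕ} (x : BitVec (n * s)) (i : Fin n) :
    (charAt x i).toNat = x.toNat / 2 ^ ((i : ℕ) * s) % 2 ^ s := by
  simp [charAt, BitVec.extractLsb'_toNat, Nat.shiftRight_eq_div_pow]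

theorem charAt_injective {n s : ℕ} :
    Function.Injective fun (x : BitVec (n * s)) (i : Fin n) => charAt x i := by
  intro x y hxy
  apply BitVec.eq_of_getLsbD_eq
  intro i hi
  have hs : 0 < s := Nat.pos_of_ne_zero fun h => by simp [h] at hi
  have hq : i / s < n := Nat.div_lt_of_lt_mul (by rwa [Nat.mul_comm])
  have h := congrArg (fun z : BitVec s => z.getLsbD (i % s)) (congrFun hxy ⟨i / s, hq⟩)
  simp only [charAt, BitVec.getLsbD_extractLsb', Nat.mod_lt _ hs, decide_true, Bool.true_and] at h
  rwa [Nat.div_add_mod' i s] at h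

/-! ### Unique output characters and peeling -/

/-- Every nonempty set of at most `k` keys contains a key one of whose output characters is
shared with no other key of the set. -/
def UniqueOutputs {n s d t : ℕ} (k : ℕ) (h : Tables n s d t) : Prop :=
  ∀ X : Finset (BitVec (n * s)), X.Nonempty → X.card ≤ k →
    ∃ x ∈ X, ∃ j, ∀ y ∈ X, simpleTab h y j = simpleTab h x j → y = x

/-- The universal tables alone determine which bottom entries are read, so the hash value is linear
in the bottom tables. Independence thus becomes a question of surjectivity. -/
theorem recHash_xor {s b : ℕ} : ∀ (ℓ : ℕ) (h : UniversalTables s ℓ) (r r' : LeafTables s b ℓ)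
    (x : BitVec (2 ^ ℓ * s)),
    recHash ℓ h (fun p y => r p y ^^^ r' p y) x = recHash ℓ h r x ^^^ recHash ℓ h r' x
  | 0, _, _, _, _ => rfl
  | m + 1, h, r, r', x => by
      simp only [recHash]
      rw [← xorSum_xor]
      congr 1
      funext j
      exact recHash_xor m _ (fun p => r (j, p)) (fun p => r' (j, p)) _

theorem recHash_zero {s b : ℕ} (ℓ : ℕ) (h : UniversalTables s ℓ) (x : BitVec (2 ^ ℓ * s)) :
    recHash ℓ h (fun _ _ => 0#b) x = 0#b := by
  have h1 := recHash_xor (b := b) ℓ h (fun _ _ => 0#b) (fun _ _ => 0#b) x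
  simp only [BitVec.xor_self] at h1
  exact h1

/-- If all universal functions have unique output characters, then on at most `k` keys the
hash values can be prescribed arbitrarily. -/
theorem exists_leafTables {s b k : ℕ} : ∀ (ℓ : ℕ) (h : UniversalTables s ℓ),
    (∀ m, UniqueOutputs k (h m)) → ∀ (X : Finset (BitVec (2 ^ ℓ * s))), X.card ≤ k →
    ∀ v : BitVec (2 ^ ℓ * s) → BitVec b, ∃ r : LeafTables s b ℓ, ∀ x ∈ X, recHash ℓ h r x = v x
  | 0, h, _, X, _, v => by
      -- On the bottom a key is a single character, so the table can store `v` itself; the numerical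
      -- conversion bridges the types of width `s` and `2 ^ 0 * s`.
      refine ⟨fun _ y => v (BitVec.ofNat _ y.toNat), fun x _ => ?_⟩
      simp only [recHash]
      congr 1
      apply BitVec.eq_of_toNat_eq
      have hlt : x.toNat < 2 ^ s := by simpa using x.isLt
      simp [charAt_toNat, Nat.mod_eq_of_lt hlt]
  | m + 1, h, hU, X, hX, v => by
      classical
      induction hc : X.card generalizing X v with
      | zero =>
        refine ⟨fun _ _ => 0#b, fun x hx => ?_⟩
        rw [Finset.card_eq_zero.mp hc] at hx
        simp at hx
      | succ q ih =>
        obtain ⟨x, hx, j, hj⟩ := hU (Fin.last m) X (Finset.card_pos.mp (by omega)) hX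
        have hcard := Finset.card_erase_of_mem hx
        obtain ⟨r₀, hr₀⟩ := ih (X.erase x) (by omega) v (by omega)
        -- One level down, prescribe the missing correction at the unique character of `x` and zero
        -- at the `j`-th characters of the other keys. Used in branch `j` only, these tables change
        -- the value of `x` and of no other key in `X`.
        obtain ⟨r₁, hr₁⟩ := exists_leafTables (b := b) m (fun i => h i.castSucc)
          (fun i => hU i.castSucc) (X.image fun y => simpleTab (h (Fin.last m)) y j)
          (Finset.card_image_le.trans hX)
          (fun z => if z = simpleTab (h (Fin.last m)) x j then
            recHash (m + 1) h r₀ x ^^^ v x else 0#b)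
        have hcorr : ∀ y ∈ X, recHash (m + 1) h
            (fun p : Leaf (m + 1) => if p.1 = j then r₁ p.2 else fun _ => 0#b) y =
            if y = x then recHash (m + 1) h r₀ x ^^^ v x else 0#b := by
          intro y hy
          rw [recHash, xorSum_eq_single _ j]
          · simp only [if_true]
            rw [hr₁ _ (Finset.mem_image_of_mem _ hy)]
            by_cases hyx : y = x
            · rw [if_pos hyx, if_pos (by rw [hyx])]
            · rw [if_neg hyx, if_neg fun h' => hyx (hj y hy h')]
          · intro i hi
            simp only [hi, if_false]
            exact recHash_zero _ _ _
        refine ⟨fun p y => r₀ p y ^^^ (if p.1 = j then r₁ p.2 else fun _ => 0#b) y,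
          fun y hy => ?_⟩
        rw [recHash_xor, hcorr y hy]
        by_cases hyx : y = x
        · rw [if_pos hyx, hyx, xor_xor_self_left]
        · rw [if_neg hyx, hr₀ y (Finset.mem_erase.mpr ⟨hyx, hy⟩), BitVec.xor_zero]

/-! ### Independence from surjectivity -/

instance instFintypeLeaf : (ℓ : ℕ) → Fintype (Leaf ℓ)
  | 0 => inferInstanceAs (Fintype Unit)
  | m + 1 =>
    have := instFintypeLeaf m
    inferInstanceAs (Fintype (Fin (12 * 2 ^ (m + 1)) × Leaf m))

theorem card_bitVec (n : ℕ) : Fintype.card (BitVec n) = 2 ^ n := by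
  rw [Fintype.card_congr (BitVec.equivFin (m := n)).toEquiv]
  simp

theorem unif_real_apply {Ω : Type} [MeasurableSpace Ω] [MeasurableSingletonClass Ω] [Fintype Ω]
    (A : Set Ω) : (unif Ω).real A = (Nat.card A : ℝ) / Fintype.card Ω := by
  classical
  rw [measureReal_def, unif, uniformOn_univ, Measure.count_apply A.toFinite.measurableSet,
    Set.encard_eq_coe_toFinset_card]
  simp

theorem unif_apply {Ω : Type} [MeasurableSpace Ω] [MeasurableSingletonClass Ω] [Fintype Ω]
    (A : Set Ω) : unif Ω A = (Nat.card A : ENNReal) / Fintype.card Ω := by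
  classical
  rw [unif, uniformOn_univ, Measure.count_apply A.toFinite.measurableSet,
    Set.encard_eq_coe_toFinset_card]
  simp

instance isProbabilityMeasure_unif {Ω : Type} [MeasurableSpace Ω] [MeasurableSingletonClass Ω]
    [Finite Ω] [Nonempty Ω] : IsProbabilityMeasure (unif Ω) :=
  isProbabilityMeasure_uniformOn Set.finite_univ Set.univ_nonempty

/-- If the hash values of the keys `x i` can be prescribed arbitrarily, then every vector of
hash values is attained by the same number of bottom tables. -/
theorem card_fiber_mul {s b ℓ : ℕ} (h : UniversalTables s ℓ) {k : ℕ}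
    (x : Fin k → BitVec (2 ^ ℓ * s))
    (hs : ∀ v : Fin k → BitVec b, ∃ r : LeafTables s b ℓ, ∀ i, recHash ℓ h r (x i) = v i)
    (v : Fin k → BitVec b) :
    Nat.card {r : LeafTables s b ℓ | ∀ i, recHash ℓ h r (x i) = v i} *
      Fintype.card (BitVec b) ^ k = Nat.card (LeafTables s b ℓ) := by
  classical
  have hfib : ∀ v' : Fin k → BitVec b,
      Nat.card {r : LeafTables s b ℓ | ∀ i, recHash ℓ h r (x i) = v' i} =
        Nat.card {r : LeafTables s b ℓ | ∀ i, recHash ℓ h r (x i) = v i} := by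
    intro v'
    -- Exclusive-or with `r₀` is an involution that exchanges the fibers over `v` and `v'`.
    obtain ⟨r₀, hr₀⟩ := hs (fun i => v' i ^^^ v i)
    have hinv : ∀ r : LeafTables s b ℓ,
        (fun p y => (fun p y => r p y ^^^ r₀ p y : LeafTables s b ℓ) p y ^^^ r₀ p y :
          LeafTables s b ℓ) = r := by
      intro r
      funext p y
      simp only [BitVec.xor_assoc, BitVec.xor_self, BitVec.xor_zero]
    refine Nat.card_congr
      ⟨fun r => ⟨fun p y => r.1 p y ^^^ r₀ p y, fun i => ?_⟩,
        fun r => ⟨fun p y => r.1 p y ^^^ r₀ p y, fun i => ?_⟩,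
        fun r => Subtype.ext (hinv r.1), fun r => Subtype.ext (hinv r.1)⟩
    · rw [recHash_xor, hr₀, r.2 i, xor_xor_self_left]
    · rw [recHash_xor, hr₀, r.2 i, BitVec.xor_comm, BitVec.xor_assoc, BitVec.xor_self,
        BitVec.xor_zero]
  have hsum : Nat.card (LeafTables s b ℓ) = ∑ v' : Fin k → BitVec b,
      Nat.card {r : LeafTables s b ℓ | ∀ i, recHash ℓ h r (x i) = v' i} := by
    rw [← Nat.card_sigma]
    exact Nat.card_congr ⟨fun r => ⟨fun i => recHash ℓ h r (x i), r, fun _ => rfl⟩,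
      fun q => q.2.1, fun _ => rfl, fun ⟨v', r, hr⟩ => by
        obtain rfl : (fun i => recHash ℓ h r (x i)) = v' := funext hr
        rfl⟩
  rw [hsum, Finset.sum_congr rfl fun v' _ => hfib v']
  simp [Fintype.card_pi, mul_comm]

theorem unif_fiber {s b ℓ : ℕ} (h : UniversalTables s ℓ) {k : ℕ}
    (x : Fin k → BitVec (2 ^ ℓ * s))
    (hs : ∀ v : Fin k → BitVec b, ∃ r : LeafTables s b ℓ, ∀ i, recHash ℓ h r (x i) = v i)
    (v : Fin k → BitVec b) :
    unif (LeafTables s b ℓ) {r | ∀ i, recHash ℓ h r (x i) = v i} =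
      ((Fintype.card (BitVec b) : ENNReal)⁻¹) ^ k := by
  classical
  have hc := card_fiber_mul h x hs v
  rw [unif_apply, ← Nat.card_eq_fintype_card (α := LeafTables s b ℓ), ← hc, Nat.cast_mul,
    Nat.cast_pow, ← ENNReal.inv_pow]
  obtain ⟨r, hr⟩ := hs v
  have hne : Nat.card {r : LeafTables s b ℓ | ∀ i, recHash ℓ h r (x i) = v i} ≠ 0 :=
    Nat.card_ne_zero.mpr ⟨⟨⟨r, hr⟩⟩, inferInstance⟩
  rw [ENNReal.div_eq_inv_mul, ENNReal.mul_inv (Or.inl (by exact_mod_cast hne))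
    (Or.inl (ENNReal.natCast_ne_top _)), mul_comm, ← mul_assoc,
    ENNReal.mul_inv_cancel (by exact_mod_cast hne) (ENNReal.natCast_ne_top _), one_mul]

theorem le_two_pow_keyBits {u c : ℕ} : u ≤ 2 ^ (2 ^ depth c * charBits u c) := by
  have h : Nat.clog 2 u ≤ 2 ^ depth c * charBits u c :=
    le_smul_ceilDiv (by positivity : 0 < 2 ^ depth c)
  exact (Nat.le_pow_clog Nat.one_lt_two u).trans (Nat.pow_le_pow_right Nat.two_pos h)

/-- `unif_fiber` is applied to `k` keys for the joint law and to a single key for the marginals; the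
latter needs `1 ≤ K`, even for `k = 0`. -/
theorem good_of_uniqueOutputs {u c b k K : ℕ} (hk : k ≤ K) (hK : 1 ≤ K)
    (h : UniversalTables (charBits u c) (depth c)) (hU : ∀ m, UniqueOutputs K (h m)) :
    Good b k h := by
  classical
  have hkey : Function.Injective
      fun x : Fin u => BitVec.ofNat (2 ^ depth c * charBits u c) (x : ℕ) := by
    intro x y hxy
    have hxy' := congrArg BitVec.toNat hxy
    simp only [BitVec.toNat_ofNat] at hxy'
    rw [Nat.mod_eq_of_lt (x.isLt.trans_le le_two_pow_keyBits),
      Nat.mod_eq_of_lt (y.isLt.trans_le le_two_pow_keyBits)] at hxy'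
    exact Fin.ext hxy'
  have hs : ∀ (q : ℕ), q ≤ K → ∀ x : Fin q → Fin u, Function.Injective x →
      ∀ v : Fin q → BitVec b, ∃ r : LeafTables (charBits u c) b (depth c),
        ∀ i, recHash (depth c) h r (BitVec.ofNat (2 ^ depth c * charBits u c) (x i : ℕ)) = v i := by
    intro q hq x hx v
    have hinj := hkey.comp hx
    obtain ⟨r, hr⟩ := exists_leafTables (b := b) (depth c) h hU
      (Finset.univ.image fun i => BitVec.ofNat (2 ^ depth c * charBits u c) (x i : ℕ))
      (Finset.card_image_le.trans (by simpa using hq)) (Function.extend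
        (fun i => BitVec.ofNat (2 ^ depth c * charBits u c) (x i : ℕ)) v fun _ => 0#b)
    refine ⟨r, fun i => ?_⟩
    rw [hr _ (Finset.mem_image_of_mem _ (Finset.mem_univ i))]
    exact hinj.extend_apply v _ i
  have hone : ∀ (x : Fin u) (v : BitVec b),
      unif (LeafTables (charBits u c) b (depth c)) {r | tabHash h r x = v} =
        ((Fintype.card (BitVec b) : ℕ) : ENNReal)⁻¹ := by
    intro x v
    have := unif_fiber h _ (hs 1 hK (fun _ => x) (Function.injective_of_subsingleton _))
      (fun _ => v)
    simpa [tabHash] using this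
  refine ⟨fun x hx => ?_, hone⟩
  have hmeas : ∀ x : Fin u, Measurable
      fun r : LeafTables (charBits u c) b (depth c) => tabHash h r x :=
    fun x => measurable_of_finite _
  rw [iIndepFun_iff_map_fun_eq_pi_map fun i => (hmeas (x i)).aemeasurable,
    Measure.ext_iff_singleton]
  intro v
  have : ∀ i, IsProbabilityMeasure (Measure.map (fun r => tabHash h r (x i))
    (unif (LeafTables (charBits u c) b (depth c)))) :=
    fun i => Measure.isProbabilityMeasure_map (hmeas (x i)).aemeasurable
  rw [Measure.pi_singleton, Measure.map_apply (measurable_of_finite _) (measurableSet_singleton v)]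
  have h1 : ∀ i, Measure.map (fun r => tabHash h r (x i))
      (unif (LeafTables (charBits u c) b (depth c))) {v i} =
        ((Fintype.card (BitVec b) : ℕ) : ENNReal)⁻¹ := by
    intro i
    rw [Measure.map_apply (hmeas (x i)) (measurableSet_singleton _)]
    exact hone (x i) (v i)
  rw [Finset.prod_congr rfl fun i _ => h1 i, Finset.prod_const, Finset.card_univ, Fintype.card_fin,
    ← unif_fiber h _ (hs k hk x hx) v]
  congr 1
  ext r
  simp [tabHash, funext_iff]

/-! ### Sets of keys without unique output characters -/

section Descent

variable {n d : ℕ} {Φ Ψ : Type} [DecidableEq Φ] [DecidableEq Ψ]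

/-- The output positions in which the output character of `x` is shared with no other key
of `X`. -/
def uniquePositions (f : (Fin n → Φ) → Fin d → Ψ) (X : Finset (Fin n → Φ)) (x : Fin n → Φ) :
    Finset (Fin d) :=
  Finset.univ.filter fun j => ∀ y ∈ X, f y j = f x j → y = x

/-- The positions in which not all keys of `X` have the same character. -/
def varyingPositions (X : Finset (Fin n → Φ)) : Finset (Fin n) :=
  Finset.univ.filter fun i => 1 < (X.image fun x => x i).card

/-- `X` is spread over position `p`: no other position has more characters, and for each
character `α` of position `p` some key with this character collides in at least `12` output
positions with keys that have another character in position `p`. -/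
def Spread (f : (Fin n → Φ) → Fin d → Ψ) (X : Finset (Fin n → Φ)) (p : Fin n) : Prop :=
  (∀ i, (X.image fun x => x i).card ≤ (X.image fun x => x p).card) ∧
    ∀ α ∈ X.image fun x => x p, ∃ x ∈ X, x p = α ∧
      12 ≤ (Finset.univ.filter fun j => ∃ y ∈ X, y p ≠ α ∧ f y j = f x j).card

/-- Take the position `p` with the most characters. If `X` is not spread over it, some class of keys
with a fixed character in `p` has at most `t + 11` unique positions per key; pass to this class, in
which `p` no longer varies. Each descent costs 11 and removes a varying position, so `t + 11 *
(varyingPositions X).card` does not grow. It stays below `d`, whereas a single remaining key would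
have `d` unique positions. -/
theorem exists_spread (f : (Fin n → Φ) → Fin d → Ψ) (t : ℕ) (X : Finset (Fin n → Φ))
    (hX : X.Nonempty) (hu : ∀ x ∈ X, (uniquePositions f X x).card ≤ t)
    (ht : t + 11 * (varyingPositions X).card < d) :
    ∃ Y ⊆ X, ∃ p, Y.Nonempty ∧ Spread f Y p := by
  induction hr : (varyingPositions X).card using Nat.strong_induction_on generalizing X t with
  | _ r ih =>
  by_cases hr0 : r = 0
  · exfalso
    obtain ⟨x, hx⟩ := hX
    have hconst : ∀ y ∈ X, y = x := by
      intro y hy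
      funext i
      by_contra hne
      have hi : i ∈ varyingPositions X := by
        simp only [varyingPositions, Finset.mem_filter, Finset.mem_univ, true_and]
        exact Finset.one_lt_card.mpr ⟨y i, Finset.mem_image_of_mem _ hy, x i,
          Finset.mem_image_of_mem _ hx, hne⟩
      rw [Finset.card_eq_zero.mp (hr.trans hr0)] at hi
      simp at hi
    have huniv : uniquePositions f X x = Finset.univ := by
      ext j
      simp only [uniquePositions, Finset.mem_filter, Finset.mem_univ, true_and, iff_true]
      exact fun y hy _ => hconst y hy
    have := hu x hx
    rw [huniv, Finset.card_univ, Fintype.card_fin] at this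
    omega
  obtain ⟨q, hq⟩ := Finset.card_pos.mp (show 0 < (varyingPositions X).card by omega)
  obtain ⟨p, -, hp⟩ := Finset.exists_max_image Finset.univ (fun i => (X.image fun x => x i).card)
    ⟨q, Finset.mem_univ q⟩
  have hpv : p ∈ varyingPositions X := by
    simp only [varyingPositions, Finset.mem_filter, Finset.mem_univ, true_and] at hq ⊢
    exact hq.trans_le (hp q (Finset.mem_univ q))
  by_cases hsub : ∃ α ∈ X.image fun x => x p, ∀ x ∈ X.filter fun x => x p = α,
      (uniquePositions f (X.filter fun x => x p = α) x).card ≤ t + 11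
  · obtain ⟨α, hα, hall⟩ := hsub
    set X' := X.filter fun x => x p = α with hX'
    have hlt : (varyingPositions X').card < (varyingPositions X).card := by
      apply Finset.card_lt_card
      rw [Finset.ssubset_iff_of_subset]
      · refine ⟨p, hpv, ?_⟩
        simp only [varyingPositions, Finset.mem_filter, Finset.mem_univ, true_and, not_lt]
        rw [Finset.card_le_one]
        intro β hβ γ hγ
        simp only [Finset.mem_image, hX', Finset.mem_filter] at hβ hγ
        obtain ⟨x, ⟨-, hx⟩, rfl⟩ := hβ
        obtain ⟨y, ⟨-, hy⟩, rfl⟩ := hγ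
        rw [hx, hy]
      · intro i hi
        simp only [varyingPositions, Finset.mem_filter, Finset.mem_univ, true_and] at hi ⊢
        exact hi.trans_le (Finset.card_le_card
          (Finset.image_subset_image (Finset.filter_subset _ _)))
    obtain ⟨x, hx, hxα⟩ := Finset.mem_image.mp hα
    obtain ⟨Y, hY, p', hY'⟩ := ih _ (hr ▸ hlt) (t + 11) X'
      ⟨x, Finset.mem_filter.mpr ⟨hx, hxα⟩⟩ hall (by omega) rfl
    exact ⟨Y, hY.trans (Finset.filter_subset _ _), p', hY'⟩
  · push Not at hsub
    refine ⟨X, subset_rfl, p, hX, fun i => hp i (Finset.mem_univ i), fun α hα => ?_⟩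
    obtain ⟨x, hx, hxu⟩ := hsub α hα
    obtain ⟨hxX, hxα⟩ := Finset.mem_filter.mp hx
    refine ⟨x, hxX, hxα, ?_⟩
    have h1 := hu x hxX
    -- At least `t + 12` positions are unique within the class of `α` and at most `t` of them within
    -- `X`. In the other 12 or more, `x` collides with keys outside its class.
    have h2 := Finset.le_card_sdiff (uniquePositions f X x)
      (uniquePositions f (X.filter fun x => x p = α) x)
    refine le_trans (by omega) (h2.trans (Finset.card_le_card ?_))
    intro j hj
    simp only [uniquePositions, Finset.mem_sdiff, Finset.mem_filter, Finset.mem_univ, true_and,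
      not_forall] at hj ⊢
    obtain ⟨huα, y, hy, hfy, hyx⟩ := hj
    exact ⟨y, hy, fun hyα => hyx (huα y ⟨hy, hyα⟩ hfy), hfy⟩

end Descent

/-! ### Witnesses -/

/-- A certificate that a simple tabulation function has collisions: an input position `pos`,
`a` characters for each input position, and, for each character `α` of position `pos`, a key
`x α` and `12` output positions `out α r`, together with keys `y α r`. Keys are given by the
indices of their characters. -/
structure Witness (n s d a : ℕ) where
  pos : Fin n
  chars : Fin n → Fin a → BitVec s
  x : Fin a → Fin n → Fin a
  out : Fin a → Fin 12 → Fin d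
  y : Fin a → Fin 12 → Fin n → Fin a

namespace Witness

variable {n s d t a : ℕ}

def equivProd (n s d a : ℕ) : Witness n s d a ≃
    Fin n × (Fin n → Fin a → BitVec s) × (Fin a → Fin n → Fin a) × (Fin a → Fin 12 → Fin d) ×
      (Fin a → Fin 12 → Fin n → Fin a) where
  toFun W := (W.pos, W.chars, W.x, W.out, W.y)
  invFun q := ⟨q.1, q.2.1, q.2.2.1, q.2.2.2.1, q.2.2.2.2⟩
  left_inv _ := rfl
  right_inv _ := rfl

noncomputable instance : Fintype (Witness n s d a) :=
  Fintype.ofEquiv _ (equivProd n s d a).symm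

theorem card_eq : Fintype.card (Witness n s d a) =
    n * (2 ^ s) ^ (n * a) * a ^ (n * a) * d ^ (12 * a) * a ^ (12 * n * a) := by
  rw [Fintype.card_congr (equivProd n s d a)]
  simp only [Fintype.card_prod, Fintype.card_fin, Fintype.card_pi, Finset.prod_const,
    Finset.card_univ, card_bitVec]
  simp only [← pow_mul]
  ring_nf

/-- The key whose characters have the indices `z`. -/
def key (W : Witness n s d a) (z : Fin n → Fin a) : Fin n → BitVec s := fun i => W.chars i (z i)

structure Valid (W : Witness n s d a) : Prop where
  chars_injective : Function.Injective (W.chars W.pos)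
  x_pos : ∀ α, W.x α W.pos = α
  out_injective : ∀ α, Function.Injective (W.out α)
  y_pos : ∀ α r, W.y α r W.pos ≠ α

/-- The collisions claimed by the witness do occur for the tables `h`. -/
def Holds (W : Witness n s d a) (h : Tables n s d t) : Prop :=
  ∀ α r, xorSum (fun i => h i (W.key (W.x α) i) (W.out α r)) =
    xorSum (fun i => h i (W.key (W.y α r) i) (W.out α r))

end Witness

/-- Characters may repeat, so that positions with fewer characters can share the index set `Fin a`
of the position with the most. -/
theorem exists_enumeration {Φ : Type} [DecidableEq Φ] {a : ℕ} (A : Finset Φ) (hA : A.Nonempty)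
    (ha : A.card ≤ a) : ∃ g : Fin a → Φ, (∀ i, g i ∈ A) ∧ (∀ α ∈ A, ∃ i, g i = α) ∧
      (A.card = a → Function.Injective g) := by
  obtain ⟨e⟩ := Function.Embedding.nonempty_of_card_le
    (show Fintype.card A ≤ Fintype.card (Fin a) by simpa using ha)
  have : Nonempty A := hA.to_subtype
  have hs := Function.invFun_surjective e.injective
  refine ⟨fun i => (Function.invFun e i : A), fun i => (Function.invFun e i : A).2,
    fun α hα => ?_, ?_⟩
  · obtain ⟨i, hi⟩ := hs ⟨α, hα⟩
    exact ⟨i, congrArg Subtype.val hi⟩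
  · intro hcard
    have hb := (Fintype.bijective_iff_surjective_and_card (Function.invFun e)).mpr
      ⟨hs, by simp [hcard]⟩
    exact Subtype.val_injective.comp hb.1

/-- A violating set has no unique output position at all, so the descent starts with `t = 0`, and
`11 * n < d` pays for up to `n` steps. -/
theorem exists_witness {n s d t K : ℕ} (hd : 11 * n < d) (h : Tables n s d t)
    (hU : ¬ UniqueOutputs K h) :
    ∃ a ∈ Finset.Icc 2 K, ∃ W : Witness n s d a, W.Valid ∧ W.Holds h := by
  classical
  simp only [UniqueOutputs, not_forall] at hU
  obtain ⟨X₀, hne, hcard, hno⟩ := hU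
  push Not at hno
  set f : (Fin n → BitVec s) → Fin d → BitVec t := fun z j => xorSum fun i => h i (z i) j with hf
  set X := X₀.image fun x (i : Fin n) => charAt x i with hX
  have hu : ∀ x ∈ X, (uniquePositions f X x).card ≤ 0 := by
    intro x hx
    rw [Nat.le_zero, Finset.card_eq_zero, Finset.eq_empty_iff_forall_notMem]
    intro j hj
    obtain ⟨x₀, hx₀, rfl⟩ := Finset.mem_image.mp hx
    obtain ⟨y₀, hy₀, hfy, hyx⟩ := hno x₀ hx₀ j
    simp only [uniquePositions, Finset.mem_filter, Finset.mem_univ, true_and] at hj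
    exact hyx (charAt_injective (hj _ (Finset.mem_image_of_mem _ hy₀) hfy))
  have hv : (varyingPositions X).card ≤ n :=
    (Finset.card_le_univ _).trans (Fintype.card_fin n).le
  obtain ⟨Y, hYX, p, hYne, hmax, hsp⟩ := exists_spread f 0 X (hne.image _) hu (by omega)
  set a := (Y.image fun x => x p).card with ha
  choose g hgmem hgsurj hginj using fun i =>
    exists_enumeration (Y.image fun x => x i) (hYne.image _) (hmax i)
  have hidx : ∀ x ∈ Y, ∃ z : Fin n → Fin a, ∀ i, g i (z i) = x i := by
    intro x hx
    choose z hz using fun i => hgsurj i (x i) (Finset.mem_image_of_mem _ hx)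
    exact ⟨z, hz⟩
  have hrow : ∀ α : Fin a, ∃ (x : Fin n → Fin a) (J : Fin 12 → Fin d)
      (y : Fin 12 → Fin n → Fin a), x p = α ∧ Function.Injective J ∧ (∀ r, y r p ≠ α) ∧
        ∀ r, f (fun i => g i (x i)) (J r) = f (fun i => g i (y r i)) (J r) := by
    intro α
    obtain ⟨x, hx, hxp, h12⟩ := hsp (g p α) (hgmem p α)
    obtain ⟨J⟩ := Function.Embedding.nonempty_of_card_le
      (show Fintype.card (Fin 12) ≤ Fintype.card
        (Finset.univ.filter fun j => ∃ y ∈ Y, y p ≠ g p α ∧ f y j = f x j) by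
          rwa [Fintype.card_fin, Fintype.card_coe])
    have hJ : ∀ r, ∃ y ∈ Y, y p ≠ g p α ∧ f y (J r) = f x (J r) := fun r =>
      (Finset.mem_filter.mp (J r).2).2
    choose y hyY hyp hyf using hJ
    obtain ⟨x', hx'⟩ := hidx x hx
    choose y' hy' using fun r => hidx (y r) (hyY r)
    refine ⟨x', fun r => J r, y', hginj p rfl ((hx' p).trans hxp),
      Subtype.val_injective.comp J.injective, fun r hr => hyp r ?_, fun r => ?_⟩
    · rw [← hy' r p, hr]
    · rw [funext hx', funext (hy' r), hyf r]
  choose x J y hx hJ hy hfxy using hrow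
  refine ⟨a, ?_, ⟨p, g, x, J, y⟩, ⟨hginj p rfl, hx, hJ, hy⟩, hfxy⟩
  rw [Finset.mem_Icc]
  constructor
  -- A collision partner has another character in position `p`, so there are at least two of them.
  · obtain ⟨x₁, hx₁⟩ := hYne
    obtain ⟨i, -⟩ := hidx x₁ hx₁
    have h1 : (i p : ℕ) < a := (i p).isLt
    have h2 := (y (i p) 0 p).isLt
    have h3 : ((y (i p) 0 p : Fin a) : ℕ) ≠ (i p : ℕ) := fun h => hy (i p) 0 (Fin.ext h)
    omega
  · exact Finset.card_image_le.trans
      ((Finset.card_le_card hYX).trans (Finset.card_image_le.trans hcard))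

/-! ### Counting the tables that satisfy a witness -/

/-- A triangular system of equations: if the value of each pivot variable `v i` is determined
by the variables other than the pivots of rank at most that of `i`, then each equation reduces the
number of solutions by a factor `|G|`. -/
theorem card_mul_pow_le_of_triangular {Z I G : Type} [Fintype Z] [Fintype I] [Fintype G]
    (v : I → Z) (hv : Function.Injective v) (ρ : I → ℕ) (E : Set (Z → G))
    (hE : ∀ h ∈ E, ∀ h' ∈ E, ∀ i, (∀ z, (∀ i', ρ i' ≤ ρ i → v i' ≠ z) → h z = h' z) →
      h (v i) = h' (v i)) :
    Nat.card E * Fintype.card G ^ Fintype.card I ≤ Nat.card (Z → G) := by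
  classical
  have hcard : Fintype.card G ^ Fintype.card I = Nat.card (I → G) := by
    rw [Nat.card_eq_fintype_card, Fintype.card_fun]
  rw [hcard, ← Nat.card_prod]
  -- Overwriting the pivots of a solution by arbitrary values loses nothing: the entries off the
  -- pivots survive and determine the original pivots, from the highest rank downwards.
  refine Nat.card_le_card_of_injective
    (fun q : E × (I → G) => Function.extend v q.2 q.1.1) ?_
  rintro ⟨⟨h, hh⟩, g⟩ ⟨⟨h', hh'⟩, g'⟩ heq
  simp only at heq
  have hg : g = g' := by
    funext i
    have := congrFun heq (v i)
    rwa [hv.extend_apply, hv.extend_apply] at this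
  have hoff : ∀ z, (∀ i, v i ≠ z) → h z = h' z := by
    intro z hz
    have := congrFun heq z
    rwa [Function.extend_apply' _ _ _ fun ⟨i, hi⟩ => hz i hi,
      Function.extend_apply' _ _ _ fun ⟨i, hi⟩ => hz i hi] at this
  obtain ⟨B, hB⟩ : ∃ B, ∀ i, ρ i < B :=
    ⟨Finset.univ.sup ρ + 1, fun i => Nat.lt_succ_of_le (Finset.le_sup (Finset.mem_univ i))⟩
  have hpiv : ∀ m i, B - ρ i = m → h (v i) = h' (v i) := by
    intro m
    induction m using Nat.strong_induction_on with
    | _ m ih =>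
    intro i hi
    refine hE h hh h' hh' i fun z hz => ?_
    by_cases hz' : ∃ i', v i' = z
    · obtain ⟨i', rfl⟩ := hz'
      have hlt : ρ i < ρ i' := by
        by_contra hle
        exact hz i' (not_lt.mp hle) rfl
      have := hB i'
      exact ih (B - ρ i') (by omega) i' rfl
    · push Not at hz'
      exact hoff z hz'
  have hhh : h = h' := by
    funext z
    by_cases hz' : ∃ i', v i' = z
    · obtain ⟨i, rfl⟩ := hz'
      exact hpiv _ i rfl
    · push Not at hz'
      exact hoff z hz'
  subst hhh hg
  rfl

/-- Solves a collision equation for the table entry of the position `p` on the `x` side. -/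
theorem apply_eq_of_sum_eq {n : ℕ} {M : Type} [AddCommGroup M] {f g f' g' : Fin n → M} (p : Fin n)
    (h : ∑ i, f i = ∑ i, g i) (h' : ∑ i, f' i = ∑ i, g' i) (hg : g = g')
    (hf : ∀ i, i ≠ p → f i = f' i) : f p = f' p := by
  subst hg
  have h1 := h.trans h'.symm
  rw [Fintype.sum_eq_add_sum_compl p f, Fintype.sum_eq_add_sum_compl p f',
    Finset.sum_congr rfl fun i hi => hf i (by simpa using hi)] at h1
  exact add_right_cancel h1

namespace Witness

variable {n s d t a : ℕ}

/-- The pivot of the equation `(α, r)` is the entry of position `pos` for character `α` and output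
`out α r`. Only one other entry of position `pos` occurs in the equation, and its character has
higher rank; entries of other positions are no pivots. Hence the system is triangular. -/
theorem card_holds_mul_le_of_rank (W : Witness n s d a) (hW : W.Valid) (ρ : Fin a → ℕ) :
    Nat.card {h : Tables n s d t | W.Holds h} *
      (2 ^ t) ^ Nat.card {q : Fin a × Fin 12 // ρ q.1 < ρ (W.y q.1 q.2 W.pos)} ≤
    Nat.card (Tables n s d t) := by
  classical
  let e : Tables n s d t ≃ (Fin n × BitVec s × Fin d → BitVec t) :=
    ⟨fun h z => h z.1 z.2.1 z.2.2, fun h i c j => h (i, c, j), fun _ => rfl, fun _ => rfl⟩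
  have hcong : Nat.card {h : Tables n s d t | W.Holds h} =
      Nat.card {h : Fin n × BitVec s × Fin d → BitVec t | W.Holds (e.symm h)} :=
    Nat.card_congr (e.subtypeEquiv fun h => by simp)
  rw [hcong, Nat.card_congr e, ← card_bitVec t, Nat.card_eq_fintype_card
      (α := {q : Fin a × Fin 12 // ρ q.1 < ρ (W.y q.1 q.2 W.pos)})]
  refine card_mul_pow_le_of_triangular
    (fun q : {q : Fin a × Fin 12 // ρ q.1 < ρ (W.y q.1 q.2 W.pos)} =>
      (W.pos, W.chars W.pos q.1.1, W.out q.1.1 q.1.2)) ?_ (fun q => ρ q.1.1) _ ?_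
  · rintro ⟨⟨α, r⟩, hq⟩ ⟨⟨α', r'⟩, hq'⟩ heq
    simp only [Prod.mk.injEq, true_and] at heq
    obtain rfl := hW.chars_injective heq.1
    obtain rfl := hW.out_injective _ heq.2
    rfl
  · rintro h hh h' hh' ⟨⟨α, r⟩, hq⟩ hag
    have key := apply_eq_of_sum_eq (M := XorVec t) W.pos (hh α r) (hh' α r) ?_ ?_
    · simp only [e, Witness.key, hW.x_pos, Equiv.coe_fn_symm_mk] at key
      exact key
    · funext i
      apply hag
      rintro ⟨⟨α', r'⟩, hq'⟩ hρ heq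
      simp only [Prod.mk.injEq] at heq hρ hq
      obtain ⟨rfl, h2, -⟩ := heq
      rw [hW.chars_injective h2] at hρ
      omega
    · intro i hi
      apply hag
      rintro ⟨⟨α', r'⟩, hq'⟩ hρ heq
      simp only [Prod.mk.injEq] at heq
      exact hi heq.1.symm

/-- Each of the `12 * a` equations relates two distinct characters of `pos`, so it is counted by the
increasing or by the decreasing order. One of the two orders gets at least half of them. -/
theorem card_holds_mul_le (W : Witness n s d a) (hW : W.Valid) :
    Nat.card {h : Tables n s d t | W.Holds h} * (2 ^ t) ^ (6 * a) ≤
      Nat.card (Tables n s d t) := by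
  classical
  have hup := W.card_holds_mul_le_of_rank (t := t) hW fun α => α
  have hdown := W.card_holds_mul_le_of_rank (t := t) hW fun α => a - α
  have htot : 12 * a ≤
      Nat.card {q : Fin a × Fin 12 // (q.1 : ℕ) < (W.y q.1 q.2 W.pos : ℕ)} +
      Nat.card {q : Fin a × Fin 12 // a - (q.1 : ℕ) < a - (W.y q.1 q.2 W.pos : ℕ)} := by
    rw [Nat.card_eq_fintype_card, Nat.card_eq_fintype_card, Fintype.card_subtype,
      Fintype.card_subtype]
    refine le_trans ?_ (Finset.card_union_le _ _)
    have : (Finset.univ : Finset (Fin a × Fin 12)).card = 12 * a := by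
      simp [mul_comm]
    rw [← this]
    apply Finset.card_le_card
    intro q _
    have hne : (W.y q.1 q.2 W.pos : ℕ) ≠ q.1 := fun h => hW.y_pos q.1 q.2 (Fin.ext h)
    have h1 := q.1.isLt
    have h2 := (W.y q.1 q.2 W.pos).isLt
    simp only [Finset.mem_union, Finset.mem_filter, Finset.mem_univ, true_and]
    omega
  have hpos : 0 < 2 ^ t := by positivity
  rcases le_or_gt (6 * a)
    (Nat.card {q : Fin a × Fin 12 // (q.1 : ℕ) < (W.y q.1 q.2 W.pos : ℕ)}) with hle | hlt
  · exact (Nat.mul_le_mul_left _ (Nat.pow_le_pow_right hpos hle)).trans hup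
  · exact (Nat.mul_le_mul_left _ (Nat.pow_le_pow_right hpos (by omega))).trans hdown

end Witness

/-! ### The probability that a level fails -/

/-- The union bound for the probability that a random simple tabulation function does not have
unique output characters. -/
noncomputable def failureBound (n s d t K : ℕ) : ℝ :=
  ∑ a ∈ Finset.Icc 2 K,
    ((n * (2 ^ s) ^ (n * a) * a ^ (n * a) * d ^ (12 * a) * a ^ (12 * n * a) : ℕ) : ℝ) /
      ((2 : ℝ) ^ t) ^ (6 * a)

theorem card_not_uniqueOutputs_le {n s d t : ℕ} (K : ℕ) (hd : 11 * n < d) :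
    (Nat.card {h : Tables n s d t | ¬ UniqueOutputs K h} : ℝ) ≤
      failureBound n s d t K * Nat.card (Tables n s d t) := by
  classical
  have hsub : {h : Tables n s d t | ¬ UniqueOutputs K h} ⊆
      ⋃ a ∈ Finset.Icc 2 K, ⋃ W ∈ Finset.univ.filter fun W : Witness n s d a => W.Valid,
        {h | W.Holds h} := by
    intro h hh
    obtain ⟨a, ha, W, hW, hWh⟩ := exists_witness hd h hh
    simp only [Set.mem_iUnion]
    exact ⟨a, ha, W, by simpa using hW, hWh⟩
  have hle : Nat.card {h : Tables n s d t | ¬ UniqueOutputs K h} ≤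
      ∑ a ∈ Finset.Icc 2 K, ∑ W ∈ Finset.univ.filter fun W : Witness n s d a => W.Valid,
        Nat.card {h : Tables n s d t | W.Holds h} := by
    simp only [Nat.card_coe_set_eq]
    refine (Set.ncard_le_ncard hsub (Set.toFinite _)).trans ?_
    refine (Finset.set_ncard_biUnion_le _ _).trans (Finset.sum_le_sum fun a _ => ?_)
    exact Finset.set_ncard_biUnion_le _ _
  refine (Nat.cast_le.mpr hle).trans ?_
  rw [Nat.cast_sum, failureBound, Finset.sum_mul]
  refine Finset.sum_le_sum fun a _ => ?_
  rw [Nat.cast_sum, ← Witness.card_eq, div_mul_eq_mul_div, mul_div_assoc, ← nsmul_eq_mul]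
  refine (Finset.sum_le_card_nsmul _ _
    ((Nat.card (Tables n s d t) : ℝ) / ((2 : ℝ) ^ t) ^ (6 * a)) fun W hW => ?_).trans ?_
  · rw [le_div_iff₀ (by positivity)]
    exact_mod_cast W.card_holds_mul_le (t := t) (Finset.mem_filter.mp hW).2
  · exact nsmul_le_nsmul_left (by positivity) (Finset.card_le_univ _)

theorem unif_univ_real_le {s ℓ K : ℕ} :
    (unif (UniversalTables s ℓ)).real {h | ¬ ∀ m, UniqueOutputs K (h m)} ≤
      ∑ m : Fin ℓ, failureBound (2 ^ ((m : ℕ) + 1)) s (12 * 2 ^ ((m : ℕ) + 1))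
        (2 ^ (m : ℕ) * s) K := by
  classical
  have hpos : (0 : ℝ) < Nat.card (UniversalTables s ℓ) := by
    exact_mod_cast Nat.card_pos
  rw [unif_real_apply, ← Nat.card_eq_fintype_card, div_le_iff₀ hpos, Finset.sum_mul]
  have hsub : {h : UniversalTables s ℓ | ¬ ∀ m, UniqueOutputs K (h m)} ⊆
      ⋃ m ∈ (Finset.univ : Finset (Fin ℓ)), {h | ¬ UniqueOutputs K (h m)} := by
    intro h hh
    simpa using hh
  have hle : Nat.card {h : UniversalTables s ℓ | ¬ ∀ m, UniqueOutputs K (h m)} ≤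
      ∑ m : Fin ℓ, Nat.card {h : UniversalTables s ℓ | ¬ UniqueOutputs K (h m)} := by
    simp only [Nat.card_coe_set_eq]
    exact (Set.ncard_le_ncard hsub (Set.toFinite _)).trans (Finset.set_ncard_biUnion_le _ _)
  refine (Nat.cast_le.mpr hle).trans ?_
  rw [Nat.cast_sum]
  refine Finset.sum_le_sum fun m _ => ?_
  have hn : 0 < 2 ^ ((m : ℕ) + 1) := by positivity
  have hlev := card_not_uniqueOutputs_le (n := 2 ^ ((m : ℕ) + 1)) (s := s)
    (d := 12 * 2 ^ ((m : ℕ) + 1)) (t := 2 ^ (m : ℕ) * s) K (by omega)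
  have hmarg : Nat.card {h : UniversalTables s ℓ | ¬ UniqueOutputs K (h m)} *
      Nat.card (LevelTables s m) ≤
      Nat.card {g : LevelTables s m | ¬ UniqueOutputs K g} * Nat.card (UniversalTables s ℓ) := by
    rw [← Nat.card_prod, ← Nat.card_prod]
    -- Exchanging the table of level `m` with an independent one shows that the failure of level `m`
    -- has the same density among all universal tables as among tables of this level.
    refine Nat.card_le_card_of_injective
      (fun q : {h : UniversalTables s ℓ | ¬ UniqueOutputs K (h m)} × LevelTables s m =>
        ((⟨q.1.1 m, q.1.2⟩ : {g : LevelTables s m | ¬ UniqueOutputs K g}),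
          (Function.update q.1.1 m q.2 : UniversalTables s ℓ))) ?_
    rintro ⟨⟨h, hh⟩, g⟩ ⟨⟨h', hh'⟩, g'⟩ heq
    simp only [Prod.mk.injEq, Subtype.mk.injEq] at heq
    obtain ⟨h1, h2⟩ := heq
    have hg : g = g' := by simpa using congrFun h2 m
    have hhh : h = h' := by
      funext i
      by_cases hi : i = m
      · subst hi
        exact h1
      · simpa [hi] using congrFun h2 i
    subst hhh hg
    rfl
  have hposl : (0 : ℝ) < Nat.card (LevelTables s m) := by exact_mod_cast Nat.card_pos
  refine le_of_mul_le_mul_right ?_ hposl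
  calc (Nat.card {h : UniversalTables s ℓ | ¬ UniqueOutputs K (h m)} : ℝ) *
        Nat.card (LevelTables s m)
      ≤ Nat.card {g : LevelTables s m | ¬ UniqueOutputs K g} *
        Nat.card (UniversalTables s ℓ) := by exact_mod_cast hmarg
    _ ≤ _ := by
        rw [mul_right_comm]
        exact mul_le_mul_of_nonneg_right hlev hpos.le

/-! ### Reasoning about programs -/

section Hoare

variable {w S : ℕ}

/-- The expression `e` evaluates without error to the word with value `n`. -/
def EvalsTo (S : ℕ) (σ : State w) (e : Expr) (n : ℕ) : Prop :=
  ∃ v, e.eval S σ = some v ∧ v.toNat = n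

/-- The program `p` terminates within `T` steps in a state that satisfies `Q`. -/
def Runs (S : ℕ) (p : Cmd) (σ : State w) (T : ℕ) (Q : State w → Prop) : Prop :=
  ∃ t σ', Exec S p σ t σ' ∧ t ≤ T ∧ Q σ'

namespace EvalsTo

variable {σ : State w} {e e₁ e₂ : Expr} {a b : ℕ}

theorem lit (n : ℕ) (hn : n < 2 ^ w) : EvalsTo S σ (.lit n) n :=
  ⟨_, rfl, by simp [Nat.mod_eq_of_lt hn]⟩

theorem reg (i : ℕ) (h : (σ.reg i).toNat = a) : EvalsTo S σ (.reg i) a := ⟨_, rfl, h⟩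

theorem load (he : EvalsTo S σ e a) (ha : a < S) (hm : (σ.mem a).toNat = b) :
    EvalsTo S σ (.load e) b := by
  obtain ⟨v, hv, rfl⟩ := he
  exact ⟨_, by simp [Expr.eval, hv, ha], hm⟩

theorem bin {o : Op} {c : ℕ} (h₁ : EvalsTo S σ e₁ a) (h₂ : EvalsTo S σ e₂ b)
    (h : ∀ x y : BitVec w, x.toNat = a → y.toNat = b → (o.eval x y).toNat = c) :
    EvalsTo S σ (.bin o e₁ e₂) c := by
  obtain ⟨x, hx, hx'⟩ := h₁
  obtain ⟨y, hy, hy'⟩ := h₂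
  exact ⟨_, by simp [Expr.eval, hx, hy], h x y hx' hy'⟩

theorem add (h₁ : EvalsTo S σ e₁ a) (h₂ : EvalsTo S σ e₂ b) (h : a + b < 2 ^ w) :
    EvalsTo S σ (.bin .add e₁ e₂) (a + b) :=
  h₁.bin h₂ fun x y hx hy => by
    simp only [Op.eval, BitVec.toNat_add, hx, hy, Nat.mod_eq_of_lt h]

theorem mul (h₁ : EvalsTo S σ e₁ a) (h₂ : EvalsTo S σ e₂ b) (h : a * b < 2 ^ w) :
    EvalsTo S σ (.bin .mul e₁ e₂) (a * b) :=
  h₁.bin h₂ fun x y hx hy => by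
    simp only [Op.eval, BitVec.toNat_mul, hx, hy, Nat.mod_eq_of_lt h]

theorem sub (h₁ : EvalsTo S σ e₁ a) (h₂ : EvalsTo S σ e₂ b) (h : b ≤ a) :
    EvalsTo S σ (.bin .sub e₁ e₂) (a - b) :=
  h₁.bin h₂ fun x y hx hy => by
    rw [Op.eval, BitVec.toNat_sub_of_le (by simpa [BitVec.le_def, hx, hy] using h), hx, hy]

theorem div (h₁ : EvalsTo S σ e₁ a) (h₂ : EvalsTo S σ e₂ b) :
    EvalsTo S σ (.bin .div e₁ e₂) (a / b) :=
  h₁.bin h₂ fun x y hx hy => by simp [Op.eval, BitVec.toNat_udiv, hx, hy]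

theorem mod (h₁ : EvalsTo S σ e₁ a) (h₂ : EvalsTo S σ e₂ b) :
    EvalsTo S σ (.bin .mod e₁ e₂) (a % b) :=
  h₁.bin h₂ fun x y hx hy => by simp [Op.eval, BitVec.toNat_umod, hx, hy]

theorem xor (h₁ : EvalsTo S σ e₁ a) (h₂ : EvalsTo S σ e₂ b) :
    EvalsTo S σ (.bin .xor e₁ e₂) (a ^^^ b) :=
  h₁.bin h₂ fun x y hx hy => by simp [Op.eval, BitVec.toNat_xor, hx, hy]

theorem shl (h₁ : EvalsTo S σ e₁ a) (h₂ : EvalsTo S σ e₂ b) (h : a * 2 ^ b < 2 ^ w) :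
    EvalsTo S σ (.bin .shl e₁ e₂) (a * 2 ^ b) :=
  h₁.bin h₂ fun x y hx hy => by
    simp [Op.eval, BitVec.toNat_shiftLeft, hx, hy, Nat.shiftLeft_eq, Nat.mod_eq_of_lt h]

theorem shr (h₁ : EvalsTo S σ e₁ a) (h₂ : EvalsTo S σ e₂ b) :
    EvalsTo S σ (.bin .shr e₁ e₂) (a / 2 ^ b) :=
  h₁.bin h₂ fun x y hx hy => by
    simp [Op.eval, BitVec.toNat_ushiftRight, hx, hy, Nat.shiftRight_eq_div_pow]

theorem lt (h₁ : EvalsTo S σ e₁ a) (h₂ : EvalsTo S σ e₂ b) (hw : 1 < 2 ^ w) :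
    EvalsTo S σ (.bin .lt e₁ e₂) (if a < b then 1 else 0) :=
  h₁.bin h₂ fun x y hx hy => by
    simp only [Op.eval, BitVec.lt_def, hx, hy]
    split_ifs
    · change (BitVec.ofNat w 1).toNat = 1
      rw [BitVec.toNat_ofNat, Nat.mod_eq_of_lt hw]
    · change (BitVec.ofNat w 0).toNat = 0
      simp

end EvalsTo

namespace Runs

variable {σ : State w} {p q : Cmd} {T T₁ T₂ : ℕ} {Q Q' : State w → Prop} {e : Expr} {a : ℕ}

theorem mono (h : Runs S p σ T₁ Q) (hT : T₁ ≤ T₂) (hQ : ∀ σ', Q σ' → Q' σ') :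
    Runs S p σ T₂ Q' := by
  obtain ⟨t, σ', hE, ht, hq⟩ := h
  exact ⟨t, σ', hE, ht.trans hT, hQ _ hq⟩

theorem assign (i : ℕ) (he : EvalsTo S σ e a)
    (hQ : ∀ v : BitVec w, v.toNat = a → Q { σ with reg := Function.update σ.reg i v }) :
    Runs S (.assign i e) σ (e.cost + 1) Q := by
  obtain ⟨v, hv, hva⟩ := he
  exact ⟨_, _, .assign hv, le_rfl, hQ v hva⟩

theorem seq (h : Runs S p σ T₁ fun σ' => Runs S q σ' T₂ Q) :
    Runs S (.seq p q) σ (T₁ + T₂) Q := by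
  obtain ⟨t₁, σ₁, hE₁, ht₁, t₂, σ₂, hE₂, ht₂, hQ⟩ := h
  exact ⟨_, _, .seq hE₁ hE₂, by omega, hQ⟩

/-- An assignment followed by further commands. -/
theorem assign_seq (i : ℕ) (he : EvalsTo S σ e a)
    (hQ : ∀ v : BitVec w, v.toNat = a →
      Runs S q { σ with reg := Function.update σ.reg i v } T Q) :
    Runs S (.seq (.assign i e) q) σ (e.cost + 1 + T) Q :=
  seq (assign i he hQ)

theorem loop_end (he : EvalsTo S σ e 0) (hQ : Q σ) : Runs S (.loop e p) σ (e.cost + 1) Q := by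
  obtain ⟨v, hv, hva⟩ := he
  exact ⟨_, _, .loop_false hv (BitVec.eq_of_toNat_eq (by simpa using hva)), le_rfl, hQ⟩

theorem loop_step (he : EvalsTo S σ e a) (ha : a ≠ 0)
    (h : Runs S p σ T₁ fun σ' => Runs S (.loop e p) σ' T₂ Q) :
    Runs S (.loop e p) σ (e.cost + T₁ + T₂ + 1) Q := by
  obtain ⟨v, hv, hva⟩ := he
  obtain ⟨t₁, σ₁, hE₁, ht₁, t₂, σ₂, hE₂, ht₂, hQ⟩ := h
  refine ⟨_, _, .loop_true hv (fun h0 => ha ?_) hE₁ hE₂, by omega, hQ⟩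
  rw [← hva, h0]
  simp

/-- A loop that is executed `n` times and whose body takes at most `T` steps. -/
theorem loop_count (I : ℕ → State w → Prop) (n : ℕ)
    (hstep : ∀ k < n, ∀ σ, I k σ → EvalsTo S σ e 1 ∧ Runs S p σ T (I (k + 1)))
    (hend : ∀ σ, I n σ → EvalsTo S σ e 0 ∧ Q σ) (h0 : I 0 σ) :
    Runs S (.loop e p) σ (n * (e.cost + T + 1) + (e.cost + 1)) Q := by
  suffices h : ∀ m k, k + m = n → ∀ σ, I k σ →
      Runs S (.loop e p) σ (m * (e.cost + T + 1) + (e.cost + 1)) Q from h n 0 (by omega) σ h0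
  intro m
  induction m with
  | zero =>
    intro k hk σ hI
    obtain rfl : k = n := by omega
    exact (loop_end (hend σ hI).1 (hend σ hI).2).mono (by omega) fun _ h => h
  | succ m ih =>
    intro k hk σ hI
    obtain ⟨he, hp⟩ := hstep k (by omega) σ hI
    refine (loop_step he one_ne_zero (hp.mono le_rfl fun σ' hI' =>
      ih (k + 1) (by omega) σ' hI')).mono ?_ fun _ h => h
    rw [Nat.succ_mul]
    omega

end Runs

end Hoare

/-! ### Recursive tabulation as an exclusive-or over the leaves -/

theorem sum_equiv_prod {M : Type} [AddCommMonoid M] {I J N : Type} [Fintype I] [Fintype J]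
    [Fintype N] (e : I × J ≃ N) (f : N → M) : ∑ q, f q = ∑ j, ∑ i, f (e (i, j)) := by
  rw [← Fintype.sum_prod_type_right (f := fun q : I × J => f (e q))]
  exact (Equiv.sum_comp e f).symm

theorem xorSum_equiv_prod {k m n b : ℕ} (e : Fin k × Fin m ≃ Fin n) (f : Fin n → BitVec b) :
    xorSum f = xorSum fun j => xorSum fun i => f (e (i, j)) :=
  sum_equiv_prod (M := XorVec b) e f

/-- The exclusive-or of the first `k` terms of a sequence. -/
def xorPrefix {b : ℕ} (g : ℕ → BitVec b) : ℕ → BitVec b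
  | 0 => 0#b
  | k + 1 => xorPrefix g k ^^^ g k

theorem xorPrefix_eq_xorSum {b : ℕ} (g : ℕ → BitVec b) : ∀ (n : ℕ) (f : Fin n → BitVec b),
    (∀ i : Fin n, g i = f i) → xorPrefix g n = xorSum f
  | 0, _, _ => rfl
  | n + 1, f, h => by
      rw [xorPrefix, xorSum_succ, xorPrefix_eq_xorSum g n (fun i => f i.castSucc)
        fun i => h i.castSucc, ← h (Fin.last n)]
      rfl

/-- The number of output positions on the bottom of a recursion of depth `ℓ`. -/
def leafCount : ℕ → ℕ
  | 0 => 1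
  | m + 1 => leafCount m * (12 * 2 ^ (m + 1))

theorem leafCount_pos : ∀ ℓ, 0 < leafCount ℓ
  | 0 => Nat.one_pos
  | m + 1 => Nat.mul_pos (leafCount_pos m) (by positivity)

/-- The output position chosen on level `m + 1` by the leaf number `q`. -/
def leafDigit (m q : ℕ) : Fin (12 * 2 ^ (m + 1)) :=
  ⟨q % (12 * 2 ^ (m + 1)), Nat.mod_lt _ (by positivity)⟩

/-- The leaf with number `q`. -/
def leafOf : (ℓ : ℕ) → ℕ → Leaf ℓ
  | 0, _ => ()
  | m + 1, q => (leafDigit m q, leafOf m (q / (12 * 2 ^ (m + 1))))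

/-- The key that arrives at the leaf with number `q`. -/
def leafKey {s : ℕ} : (ℓ : ℕ) → UniversalTables s ℓ → BitVec (2 ^ ℓ * s) → ℕ → BitVec (2 ^ 0 * s)
  | 0, _, x, _ => x
  | m + 1, h, x, q => leafKey m (fun i => h i.castSucc)
      (simpleTab (h (Fin.last m)) x (leafDigit m q)) (q / (12 * 2 ^ (m + 1)))

/-- Unrolling lets the query run with a leaf counter instead of a stack. Leaf numbers are in mixed
radix, the least significant digit being the output position on the top level, as in
`finProdFinEquiv`. -/
theorem recHash_eq_xorSum {s b : ℕ} : ∀ (ℓ : ℕ) (h : UniversalTables s ℓ)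
    (r : LeafTables s b ℓ) (x : BitVec (2 ^ ℓ * s)),
    recHash ℓ h r x = xorSum fun q : Fin (leafCount ℓ) =>
      r (leafOf ℓ q) (charAt (leafKey ℓ h x q) ⟨0, Nat.one_pos⟩)
  | 0, h, r, x => by
      refine Eq.trans ?_ (xorSum_eq_single (n := 1) (b := b) _ 0
        fun i hi => absurd (Subsingleton.elim i 0) hi).symm
      rfl
  | m + 1, h, r, x => by
      refine Eq.trans ?_ (xorSum_equiv_prod (b := b)
        (finProdFinEquiv (m := leafCount m) (n := 12 * 2 ^ (m + 1))) _).symm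
      rw [recHash]
      congr 1
      funext j
      rw [recHash_eq_xorSum m]
      congr 1
      funext q
      have hpos : 0 < 12 * 2 ^ (m + 1) := by positivity
      have hdig : leafDigit m (finProdFinEquiv (q, j)) = j := by
        apply Fin.ext
        simp [leafDigit, Nat.add_mul_mod_self_left, Nat.mod_eq_of_lt j.isLt]
      have hdiv : (finProdFinEquiv (q, j) : ℕ) / (12 * 2 ^ (m + 1)) = q := by
        rw [finProdFinEquiv_apply_val, Nat.add_mul_div_left _ _ hpos,
          Nat.div_eq_of_lt j.isLt, Nat.zero_add]
      simp only [leafOf, leafKey]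
      rw [hdig, hdiv]

/-! ### Memory layout

The memory starts with seven parameters, which are followed by the universal tables and the
bottom tables. -/

/-- The address of output character `j` for the input character `ch` in position `i` on level
`lev`. -/
def univAddr (ℓ s lev i ch j : ℕ) : ℕ :=
  7 + (((lev * 2 ^ ℓ + i) * 2 ^ s + ch) * (12 * 2 ^ ℓ) + j)

/-- All levels `0, …, ℓ` are padded to the shape of the largest one, which makes addresses uniform;
the slot of level `0` stays empty. -/
def leafBase (ℓ s : ℕ) : ℕ := 7 + (ℓ + 1) * 2 ^ ℓ * 2 ^ s * (12 * 2 ^ ℓ)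

def memSize (ℓ s : ℕ) : ℕ := leafBase ℓ s + leafCount ℓ * 2 ^ s

/-- The memory contents `M` represent the tables `h` and `r`. -/
structure Represents {w ℓ s b : ℕ} (M : ℕ → BitVec w) (h : UniversalTables s ℓ)
    (r : LeafTables s b ℓ) : Prop where
  depth : (M 0).toNat = ℓ
  bits : (M 1).toNat = s
  count : (M 2).toNat = leafCount ℓ
  positions : (M 3).toNat = 2 ^ ℓ
  chars : (M 4).toNat = 2 ^ s
  outputs : (M 5).toNat = 12 * 2 ^ ℓ
  base : (M 6).toNat = leafBase ℓ s
  univ : ∀ (m : Fin ℓ) (i : Fin (2 ^ ((m : ℕ) + 1))) (ch : BitVec s)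
    (j : Fin (12 * 2 ^ ((m : ℕ) + 1))),
    (M (univAddr ℓ s (m + 1) i ch.toNat j)).toNat = (h m i ch j).toNat
  leaf : ∀ q < leafCount ℓ, ∀ ch : BitVec s,
    (M (leafBase ℓ s + (q * 2 ^ s + ch.toNat))).toNat = (r (leafOf ℓ q) ch).toNat

theorem mul_add_lt_mul {a b A B : ℕ} (ha : a < A) (hb : b < B) : a * B + b < A * B :=
  calc a * B + b < a * B + B := by omega
    _ = (a + 1) * B := by ring
    _ ≤ A * B := Nat.mul_le_mul_right _ ha

theorem univAddr_lt_leafBase {ℓ s lev i ch j : ℕ} (hlev : lev ≤ ℓ) (hi : i < 2 ^ ℓ)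
    (hch : ch < 2 ^ s) (hj : j < 12 * 2 ^ ℓ) : univAddr ℓ s lev i ch j < leafBase ℓ s := by
  have := mul_add_lt_mul (mul_add_lt_mul (mul_add_lt_mul (Nat.lt_succ_of_le hlev) hi) hch) hj
  rw [univAddr, leafBase]
  exact Nat.add_lt_add_left this 7

theorem leafBase_le_memSize (ℓ s : ℕ) : leafBase ℓ s ≤ memSize ℓ s := Nat.le_add_right _ _

theorem leafAddr_lt_memSize {ℓ s q ch : ℕ} (hq : q < leafCount ℓ) (hch : ch < 2 ^ s) :
    leafBase ℓ s + (q * 2 ^ s + ch) < memSize ℓ s :=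
  Nat.add_lt_add_left (mul_add_lt_mul hq hch) _

/-- Follows from `A + B ≤ A * B + 1` for positive `A` and `B`. It is the linear fact from which
`omega` excludes overflow of small quantities. -/
theorem add_le_leafBase (ℓ s : ℕ) :
    7 + (ℓ + 1) * 2 ^ ℓ * 2 ^ s + 12 * 2 ^ ℓ ≤ leafBase ℓ s + 1 := by
  rw [leafBase]
  have h1 : 1 ≤ (ℓ + 1) * 2 ^ ℓ * 2 ^ s := Nat.one_le_iff_ne_zero.mpr (by positivity)
  have h2 : 1 ≤ 2 ^ ℓ := Nat.one_le_two_pow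
  nlinarith

/-! ### The query program -/

/-- The address of the table entry that is needed for input position `reg 8` of the key
`reg 3`. -/
def univAddrExpr : Expr :=
  .bin .add (.lit 7) (.bin .add (.bin .mul (.bin .add (.bin .mul
    (.bin .add (.bin .mul (.reg 5) (.load (.lit 3))) (.reg 8)) (.load (.lit 4)))
    (.bin .mod (.bin .shr (.reg 3) (.bin .mul (.reg 8) (.load (.lit 1)))) (.load (.lit 4))))
    (.load (.lit 5))) (.reg 6))

/-- Output character `reg 6` of the simple tabulation function of level `reg 5`, for the key
`reg 3`; the result is left in `reg 7`. -/
def simpleTabLoop : Cmd :=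
  .loop (.bin .lt (.reg 8) (.bin .shl (.lit 1) (.reg 5)))
    (.seq (.assign 7 (.bin .xor (.reg 7) (.load univAddrExpr)))
      (.assign 8 (.bin .add (.reg 8) (.lit 1))))

/-- Replaces the key `reg 3` of level `reg 5` by the key that arrives at the leaf with
number `reg 4`. -/
def descendLoop : Cmd :=
  .loop (.reg 5)
    (.seq (.assign 6 (.bin .mod (.reg 4) (.bin .shl (.lit 12) (.reg 5))))
    (.seq (.assign 4 (.bin .div (.reg 4) (.bin .shl (.lit 12) (.reg 5))))
    (.seq (.assign 7 (.lit 0))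
    (.seq (.assign 8 (.lit 0))
    (.seq simpleTabLoop
    (.seq (.assign 3 (.reg 7))
      (.assign 5 (.bin .sub (.reg 5) (.lit 1)))))))))

/-- The address of the bottom table entry of leaf `reg 1` for the character `reg 3`. -/
def leafAddrExpr : Expr :=
  .bin .add (.load (.lit 6)) (.bin .add (.bin .mul (.reg 1) (.load (.lit 4))) (.reg 3))

/-- Accumulates in `reg 2` the bottom table entries of all leaves. -/
def leafLoop : Cmd :=
  .loop (.bin .lt (.reg 1) (.load (.lit 2)))
    (.seq (.assign 3 (.reg 0))
    (.seq (.assign 4 (.reg 1))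
    (.seq (.assign 5 (.load (.lit 0)))
    (.seq descendLoop
    (.seq (.assign 2 (.bin .xor (.reg 2) (.load leafAddrExpr)))
      (.assign 1 (.bin .add (.reg 1) (.lit 1))))))))

/-- The query program. -/
def queryProgram : Cmd :=
  .seq (.assign 1 (.lit 0)) (.seq (.assign 2 (.lit 0)) (.seq leafLoop (.assign 0 (.reg 2))))

section Correctness

variable {w ℓ s b : ℕ} {M : ℕ → BitVec w} {h : UniversalTables s ℓ} {r : LeafTables s b ℓ}

theorem EvalsTo.header {σ : State w} {k a S : ℕ} (hS : 7 ≤ S) (hw : S < 2 ^ w) (hk : k < 7)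
    (hσ : σ.mem = M) (hM : (M k).toNat = a) : EvalsTo S σ (.load (.lit k)) a :=
  EvalsTo.load (EvalsTo.lit k (by omega)) (by omega) (by rw [hσ, hM])

theorem simpleTabLoop_runs (hw : memSize ℓ s < 2 ^ w) (hM : Represents M h r) {m : ℕ}
    (hm : m + 1 ≤ ℓ) (T : LevelTables s m)
    (hT : ∀ (i : Fin (2 ^ (m + 1))) (ch : BitVec s) (j : Fin (12 * 2 ^ (m + 1))),
      (M (univAddr ℓ s (m + 1) i ch.toNat j)).toNat = (T i ch j).toNat)
    (x : BitVec (2 ^ (m + 1) * s)) (j : Fin (12 * 2 ^ (m + 1))) (σ : State w) (hσ : σ.mem = M)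
    (h3 : (σ.reg 3).toNat = x.toNat) (h5 : (σ.reg 5).toNat = m + 1)
    (h6 : (σ.reg 6).toNat = j) (h7 : (σ.reg 7).toNat = 0) (h8 : (σ.reg 8).toNat = 0) :
    Runs (memSize ℓ s) simpleTabLoop σ (70 * 2 ^ (m + 1)) fun σ' =>
      σ'.mem = M ∧ (σ'.reg 7).toNat = (simpleTab T x j).toNat ∧
        ∀ k < 7, σ'.reg k = σ.reg k := by
  have hsize := leafBase_le_memSize ℓ s
  have hbig := add_le_leafBase ℓ s
  have hpowm : 2 ^ (m + 1) ≤ 2 ^ ℓ := Nat.pow_le_pow_right Nat.two_pos hm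
  have hNF : 2 ^ ℓ * 2 ^ s ≤ (ℓ + 1) * 2 ^ ℓ * 2 ^ s := by
    rw [mul_assoc]
    exact Nat.le_mul_of_pos_left _ (Nat.succ_pos ℓ)
  have hN : 2 ^ ℓ ≤ 2 ^ ℓ * 2 ^ s := Nat.le_mul_of_pos_right _ (by positivity)
  have hone : 1 ≤ 2 ^ ℓ := Nat.one_le_two_pow
  have hS7 : 7 ≤ memSize ℓ s := by omega
  set g : ℕ → BitVec (2 ^ m * s) := fun i =>
    if hi : i < 2 ^ (m + 1) then T ⟨i, hi⟩ (charAt x ⟨i, hi⟩) j else 0#_ with hg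
  have hgx : xorPrefix g (2 ^ (m + 1)) = simpleTab T x j :=
    xorPrefix_eq_xorSum g _ _ fun i => by simp [hg]
  have hcond : ∀ (τ : State w) (k : ℕ), (τ.reg 8).toNat = k → (τ.reg 5).toNat = m + 1 →
      EvalsTo (memSize ℓ s) τ (.bin .lt (.reg 8) (.bin .shl (.lit 1) (.reg 5)))
        (if k < 1 * 2 ^ (m + 1) then 1 else 0) := by
    intro τ k hk h5'
    exact .lt (.reg 8 hk) (.shl (.lit 1 (by omega)) (.reg 5 h5') (by omega)) (by omega)
  refine Runs.mono (Runs.loop_count (T := 50)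
    (I := fun k τ => τ.mem = M ∧ (τ.reg 7).toNat = (xorPrefix g k).toNat ∧ (τ.reg 8).toNat = k ∧
      ∀ k < 7, τ.reg k = σ.reg k) (2 ^ (m + 1)) ?_ (fun τ hτ => ?_)
      ⟨hσ, by simpa [xorPrefix] using h7, h8, fun _ _ => rfl⟩) ?_ fun _ hq => hq
  · rintro k hk τ ⟨hτM, hτ7, hτ8, hτ⟩
    have h5' : (τ.reg 5).toNat = m + 1 := by rw [hτ 5 (by omega), h5]
    have h3' : (τ.reg 3).toNat = x.toNat := by rw [hτ 3 (by omega), h3]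
    have h6' : (τ.reg 6).toNat = j := by rw [hτ 6 (by omega), h6]
    constructor
    · simpa [hk] using hcond τ k hτ8 h5'
    have hks : k * s < 2 ^ w := by
      have : k * s ≤ 2 ^ ℓ * 2 ^ s := Nat.mul_le_mul (by omega) Nat.lt_two_pow_self.le
      omega
    have hj : (j : ℕ) < 12 * 2 ^ ℓ := by
      have := j.isLt
      omega
    have hch : x.toNat / 2 ^ (k * s) % 2 ^ s < 2 ^ s := Nat.mod_lt _ (by positivity)
    have haddr := univAddr_lt_leafBase (s := s) hm (show k < 2 ^ ℓ by omega) hch hj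
    have hentry : (M (univAddr ℓ s (m + 1) k (x.toNat / 2 ^ (k * s) % 2 ^ s) j)).toNat =
        (g k).toNat := by
      have := hT ⟨k, hk⟩ (charAt x ⟨k, hk⟩) j
      rw [charAt_toNat] at this
      simpa [hg, hk] using this
    have e1 : EvalsTo (memSize ℓ s) τ univAddrExpr
        (univAddr ℓ s (m + 1) k (x.toNat / 2 ^ (k * s) % 2 ^ s) j) := by
      have hpos : 0 < 12 * 2 ^ ℓ := by positivity
      have b1 : univAddr ℓ s (m + 1) k (x.toNat / 2 ^ (k * s) % 2 ^ s) j < 2 ^ w := by omega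
      rw [univAddr] at b1 ⊢
      -- The address is evaluated by Horner's rule; each intermediate value is at most the final
      -- address, so nothing overflows.
      have b2 := Nat.le_mul_of_pos_right
        (((m + 1) * 2 ^ ℓ + k) * 2 ^ s + x.toNat / 2 ^ (k * s) % 2 ^ s) hpos
      have b3 := Nat.le_mul_of_pos_right ((m + 1) * 2 ^ ℓ + k) (Nat.two_pow_pos s)
      have hd : ∀ k a, k < 7 → (M k).toNat = a → EvalsTo (memSize ℓ s) τ (.load (.lit k)) a :=
        fun k a hk => EvalsTo.header hS7 hw hk hτM
      exact .add (.lit 7 (by omega)) (.add (.mul (.add (.mul (.add (.mul (.reg 5 h5')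
        (hd 3 _ (by omega) hM.positions) (by omega)) (.reg 8 hτ8) (by omega))
        (hd 4 _ (by omega) hM.chars) (by omega)) (.mod (.shr (.reg 3 h3') (.mul (.reg 8 hτ8)
        (hd 1 _ (by omega) hM.bits) hks)) (hd 4 _ (by omega) hM.chars)) (by omega))
        (hd 5 _ (by omega) hM.outputs) (by omega)) (.reg 6 h6') (by omega)) (by omega)
    have e2 : EvalsTo (memSize ℓ s) τ (.bin .xor (.reg 7) (.load univAddrExpr))
        ((xorPrefix g k).toNat ^^^ (g k).toNat) :=
      .xor (.reg 7 hτ7) (.load e1 (by omega) (by rw [hτM, hentry]))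
    refine Runs.mono (Runs.assign_seq 7 e2 fun v hv => Runs.assign (a := k + 1) 8
      (.add (.reg 8 (by simpa using hτ8)) (.lit 1 (by omega)) (by omega)) fun v' hv' =>
      ⟨hτM, by simpa [xorPrefix] using hv, by simpa using hv', fun i hi => ?frame⟩) ?time
      fun _ hq => hq
    case frame =>
      simp [Function.update_of_ne (show i ≠ 8 by omega), Function.update_of_ne (show i ≠ 7 by omega),
        hτ i hi]
    case time => simp only [Expr.cost, univAddrExpr]; omega
  · obtain ⟨hτM, hτ7, hτ8, hτ⟩ := hτ
    refine ⟨?_, hτM, by rw [hτ7, hgx], hτ⟩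
    simpa using hcond τ _ hτ8 (by rw [hτ 5 (by omega), h5])
  · simp only [Expr.cost]
    have : 1 ≤ 2 ^ (m + 1) := Nat.one_le_two_pow
    omega

/-- Induction on the level: after one pass, the loop faces the same task for the output character
`leafDigit m q` and the leaf number without its last digit. Registers `0`, `1`, `2` hold the key,
the leaf counter and the accumulator and must survive. -/
theorem descendLoop_runs (hw : memSize ℓ s < 2 ^ w) (hM : Represents M h r) : ∀ (m : ℕ),
    m ≤ ℓ → ∀ (h' : UniversalTables s m),
    (∀ (m' : Fin m) (i : Fin (2 ^ ((m' : ℕ) + 1))) (ch : BitVec s)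
      (j : Fin (12 * 2 ^ ((m' : ℕ) + 1))),
      (M (univAddr ℓ s (m' + 1) i ch.toNat j)).toNat = (h' m' i ch j).toNat) →
    ∀ (x : BitVec (2 ^ m * s)) (q : ℕ) (σ : State w), σ.mem = M →
      (σ.reg 3).toNat = x.toNat → (σ.reg 4).toNat = q → (σ.reg 5).toNat = m →
      Runs (memSize ℓ s) descendLoop σ (m * (110 * 2 ^ ℓ) + 2) fun σ' =>
        σ'.mem = M ∧ (σ'.reg 3).toNat = (leafKey m h' x q).toNat ∧
          ∀ k < 3, σ'.reg k = σ.reg k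
  | 0, _, h', _, x, q, σ, hσ, h3, _, h5 =>
      (Runs.loop_end (.reg 5 h5) ⟨hσ, h3, fun _ _ => rfl⟩).mono (by simp [Expr.cost]) fun _ hq => hq
  | m + 1, hm, h', hh', x, q, σ, hσ, h3, h4, h5 => by
      have hsize := leafBase_le_memSize ℓ s
      have hbig := add_le_leafBase ℓ s
      have hpowm : 2 ^ (m + 1) ≤ 2 ^ ℓ := Nat.pow_le_pow_right Nat.two_pos hm
      have h1 : 1 ≤ (ℓ + 1) * 2 ^ ℓ * 2 ^ s := Nat.one_le_iff_ne_zero.mpr (by positivity)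
      have hone : 1 ≤ 2 ^ ℓ := Nat.one_le_two_pow
      have hml : m + 1 < 2 ^ ℓ := Nat.lt_of_le_of_lt hm Nat.lt_two_pow_self
      have e12 : ∀ τ : State w, (τ.reg 5).toNat = m + 1 →
          EvalsTo (memSize ℓ s) τ (.bin .shl (.lit 12) (.reg 5)) (12 * 2 ^ (m + 1)) :=
        fun τ hτ => .shl (.lit 12 (by omega)) (.reg 5 hτ) (by omega)
      refine Runs.mono (Runs.loop_step (.reg 5 h5) (Nat.succ_ne_zero m)
        (Runs.assign_seq 6 (.mod (.reg 4 h4) (e12 _ h5)) fun v6 h6 =>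
        Runs.assign_seq 4 (.div (.reg 4 (by simpa using h4)) (e12 _ (by simpa using h5)))
          fun v4 h4' =>
        Runs.assign_seq 7 (.lit 0 (by omega)) fun v7 h7 =>
        Runs.assign_seq 8 (.lit 0 (by omega)) fun v8 h8 =>
        Runs.seq (Runs.mono (simpleTabLoop_runs hw hM hm (h' (Fin.last m)) (hh' (Fin.last m)) x
          (leafDigit m q) _ (by simpa using hσ) (by simpa using h3) (by simpa using h5)
          (by simpa [leafDigit] using h6) (by simpa using h7) (by simpa using h8)) le_rfl
          fun σ₁ hσ₁ =>
        Runs.assign_seq 3 (.reg 7 hσ₁.2.1) fun v3 h3' =>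
        Runs.assign (a := m) 5 (.sub (a := m + 1) (.reg 5 ?lev) (.lit 1 (by omega)) (by omega))
          fun v5 h5' =>
        Runs.mono (descendLoop_runs hw hM m (by omega) (fun i => h' i.castSucc)
          (fun i => hh' i.castSucc) _ (q / (12 * 2 ^ (m + 1))) _ (by simpa using hσ₁.1)
          (by simpa using h3') ?quot (by simpa using h5')) le_rfl fun σ₂ hσ₂ =>
          ⟨hσ₂.1, hσ₂.2.1, fun k hk => ?frame⟩))) ?time fun _ hq => hq
      case lev =>
        have := hσ₁.2.2 5 (by omega)
        simp at this ⊢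
        rw [this, h5]
      case quot =>
        have := hσ₁.2.2 4 (by omega)
        simp at this ⊢
        rw [this, h4']
      case frame =>
        rw [hσ₂.2.2 k hk]
        have := hσ₁.2.2 k (by omega)
        simp only [Function.update_of_ne (show k ≠ 5 by omega),
          Function.update_of_ne (show k ≠ 3 by omega), Function.update_of_ne (show k ≠ 8 by omega),
          Function.update_of_ne (show k ≠ 7 by omega), Function.update_of_ne (show k ≠ 4 by omega),
          Function.update_of_ne (show k ≠ 6 by omega)] at this ⊢
        rw [this]
      case time =>
        simp only [Expr.cost]
        have := Nat.add_one_mul m (110 * 2 ^ ℓ)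
        omega

theorem queryProgram_runs (hw : memSize ℓ s < 2 ^ w) (hM : Represents M h r)
    (x : BitVec (2 ^ ℓ * s)) (σ : State w) (hσ : σ.mem = M) (h0 : (σ.reg 0).toNat = x.toNat) :
    Runs (memSize ℓ s) queryProgram σ (200 * (leafCount ℓ * ((ℓ + 1) * 2 ^ ℓ))) fun σ' =>
      σ'.mem = M ∧ (σ'.reg 0).toNat = (recHash ℓ h r x).toNat := by
  have hsize := leafBase_le_memSize ℓ s
  have hbig := add_le_leafBase ℓ s
  have h1 : 1 ≤ (ℓ + 1) * 2 ^ ℓ * 2 ^ s := Nat.one_le_iff_ne_zero.mpr (by positivity)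
  have hone : 1 ≤ 2 ^ ℓ := Nat.one_le_two_pow
  have hS7 : 7 ≤ memSize ℓ s := by omega
  have hF : 1 ≤ 2 ^ s := Nat.one_le_two_pow
  have hcount : leafCount ℓ ≤ leafCount ℓ * 2 ^ s := Nat.le_mul_of_pos_right _ (by positivity)
  have hcount' : leafCount ℓ * 2 ^ s ≤ memSize ℓ s := Nat.le_add_left _ _
  set g : ℕ → BitVec b := fun q =>
    r (leafOf ℓ q) (charAt (leafKey ℓ h x q) ⟨0, Nat.one_pos⟩) with hg
  have hgx : xorPrefix g (leafCount ℓ) = recHash ℓ h r x := by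
    rw [recHash_eq_xorSum]
    exact xorPrefix_eq_xorSum g _ _ fun i => rfl
  have hcond : ∀ (τ : State w) (k : ℕ), τ.mem = M → (τ.reg 1).toNat = k →
      EvalsTo (memSize ℓ s) τ (.bin .lt (.reg 1) (.load (.lit 2)))
        (if k < leafCount ℓ then 1 else 0) := by
    intro τ k hτ hk
    exact .lt (.reg 1 hk) (.header hS7 hw (by omega) hτ hM.count) (by omega)
  refine Runs.mono (Runs.assign_seq 1 (.lit 0 (by omega)) fun v1 h1' =>
    Runs.assign_seq 2 (.lit 0 (by omega)) fun v2 h2 =>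
    Runs.seq (T₂ := 2) (Runs.loop_count (T := ℓ * (110 * 2 ^ ℓ) + 50)
      (I := fun k τ => τ.mem = M ∧ (τ.reg 0).toNat = x.toNat ∧ (τ.reg 1).toNat = k ∧
        (τ.reg 2).toNat = (xorPrefix g k).toNat) (leafCount ℓ) ?step (fun τ hτ => ?fin)
      ⟨hσ, by simpa using h0, by simpa using h1', by simpa [xorPrefix] using h2⟩)) ?time
    fun _ hq => hq
  case step =>
    rintro k hk τ ⟨hτM, hτ0, hτ1, hτ2⟩
    refine ⟨by simpa [hk] using hcond τ k hτM hτ1, ?_⟩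
    refine Runs.mono (Runs.assign_seq 3 (.reg 0 hτ0) fun v3 h3 =>
      Runs.assign_seq 4 (.reg 1 (by simpa using hτ1)) fun v4 h4 =>
      Runs.assign_seq 5 (.header hS7 hw (by omega) hτM hM.depth) fun v5 h5 =>
      Runs.seq (T₂ := 25) (Runs.mono (descendLoop_runs hw hM ℓ le_rfl h hM.univ x k _ hτM
        (by simpa using h3) (by simpa using h4) (by simpa using h5)) le_rfl fun σ₁ hσ₁ => ?last))
      ?body fun _ hq => hq
    case last =>
      obtain ⟨hσM, hσ3, hσk⟩ := hσ₁
      have r0 : (σ₁.reg 0).toNat = x.toNat := by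
        rw [hσk 0 (by omega)]
        simpa using hτ0
      have r1 : (σ₁.reg 1).toNat = k := by
        rw [hσk 1 (by omega)]
        simpa using hτ1
      have r2 : (σ₁.reg 2).toNat = (xorPrefix g k).toNat := by
        rw [hσk 2 (by omega)]
        simpa using hτ2
      have hkey : (leafKey ℓ h x k).toNat < 2 ^ s := by
        simpa using (leafKey ℓ h x k).isLt
      have haddr := leafAddr_lt_memSize hk hkey
      have hentry : (M (leafBase ℓ s + (k * 2 ^ s + (leafKey ℓ h x k).toNat))).toNat =
          (g k).toNat := by
        have := hM.leaf k hk (charAt (leafKey ℓ h x k) ⟨0, Nat.one_pos⟩)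
        rw [charAt_toNat] at this
        simpa [hg, Nat.mod_eq_of_lt hkey] using this
      have e1 : EvalsTo (memSize ℓ s) σ₁ leafAddrExpr
          (leafBase ℓ s + (k * 2 ^ s + (leafKey ℓ h x k).toNat)) :=
        .add (.header hS7 hw (by omega) hσM hM.base) (.add (.mul (.reg 1 r1)
          (.header hS7 hw (by omega) hσM hM.chars) (by omega)) (.reg 3 hσ3) (by omega)) (by omega)
      have e2 : EvalsTo (memSize ℓ s) σ₁ (.bin .xor (.reg 2) (.load leafAddrExpr))
          ((xorPrefix g k).toNat ^^^ (g k).toNat) :=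
        .xor (.reg 2 r2) (.load e1 (by omega) (by rw [hσM, hentry]))
      refine Runs.mono (Runs.assign_seq 2 e2 fun v hv => Runs.assign (a := k + 1) 1
        (.add (.reg 1 (by simpa using r1)) (.lit 1 (by omega)) (by omega)) fun v' hv' =>
        ⟨hσM, by simpa using r0, by simpa using hv', by simpa [xorPrefix] using hv⟩) ?_
        fun _ hq => hq
      simp only [Expr.cost, leafAddrExpr]
      omega
    case body =>
      simp only [Expr.cost]
      omega
  case fin =>
    obtain ⟨hτM, -, hτ1, hτ2⟩ := hτ
    refine ⟨by simpa using hcond τ _ hτM hτ1, Runs.assign 0 (.reg 2 hτ2) fun v hv => ⟨hτM, ?_⟩⟩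
    rw [← hgx]
    simpa using hv
  case time =>
    simp only [Expr.cost]
    have hD := leafCount_pos ℓ
    have h2 : leafCount ℓ ≤ leafCount ℓ * ((ℓ + 1) * 2 ^ ℓ) :=
      Nat.le_mul_of_pos_right _ (by positivity)
    have h3 : leafCount ℓ * (1 + (1 + 1) + 1 + (ℓ * (110 * 2 ^ ℓ) + 50) + 1) ≤
        leafCount ℓ * (165 * ((ℓ + 1) * 2 ^ ℓ)) := by
      apply Nat.mul_le_mul_left
      nlinarith
    have h4 : leafCount ℓ * (165 * ((ℓ + 1) * 2 ^ ℓ)) =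
        165 * (leafCount ℓ * ((ℓ + 1) * 2 ^ ℓ)) := by ring
    omega

end Correctness

/-! ### The representation of the tables -/

/-- The table entry with the given indices; `0` if there is no such entry. -/
def univEntry {s ℓ : ℕ} (w : ℕ) (h : UniversalTables s ℓ) : (lev i ch j : ℕ) → BitVec w
  | 0, _, _, _ => 0#w
  | m + 1, i, ch, j =>
    if hm : m < ℓ then
      if hi : i < 2 ^ (m + 1) then
        if hj : j < 12 * 2 ^ (m + 1) then
          (h ⟨m, hm⟩ ⟨i, hi⟩ (BitVec.ofNat s ch) ⟨j, hj⟩).setWidth w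
        else 0#w
      else 0#w
    else 0#w

/-- Powers and products are stored in advance, so that the one fixed program need not compute them.
-/
def headerEntry (ℓ s : ℕ) : ℕ → ℕ
  | 0 => ℓ
  | 1 => s
  | 2 => leafCount ℓ
  | 3 => 2 ^ ℓ
  | 4 => 2 ^ s
  | 5 => 12 * 2 ^ ℓ
  | _ => leafBase ℓ s

/-- The memory contents that represent the tables `h` and `r`. -/
def tableRep {s b ℓ : ℕ} (w : ℕ) (h : UniversalTables s ℓ) (r : LeafTables s b ℓ) (a : ℕ) :
    BitVec w :=
  if a < 7 then BitVec.ofNat w (headerEntry ℓ s a)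
  else if a < leafBase ℓ s then
    univEntry w h ((a - 7) / (12 * 2 ^ ℓ) / 2 ^ s / 2 ^ ℓ) ((a - 7) / (12 * 2 ^ ℓ) / 2 ^ s % 2 ^ ℓ)
      ((a - 7) / (12 * 2 ^ ℓ) % 2 ^ s) ((a - 7) % (12 * 2 ^ ℓ))
  else (r (leafOf ℓ ((a - leafBase ℓ s) / 2 ^ s))
    (BitVec.ofNat s ((a - leafBase ℓ s) % 2 ^ s))).setWidth w

theorem mul_add_div_of_lt {a b B : ℕ} (hb : b < B) : (a * B + b) / B = a := by
  rw [Nat.mul_comm, Nat.mul_add_div (by omega), Nat.div_eq_of_lt hb, Nat.add_zero]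

theorem mul_add_mod_of_lt_right {a b B : ℕ} (hb : b < B) : (a * B + b) % B = b := by
  rw [Nat.mul_comm, Nat.mul_add_mod, Nat.mod_eq_of_lt hb]

theorem toNat_setWidth_of_le {v w : ℕ} (x : BitVec v) (h : v ≤ w) :
    (x.setWidth w).toNat = x.toNat := by
  rw [BitVec.toNat_setWidth, Nat.mod_eq_of_lt (x.isLt.trans_le (Nat.pow_le_pow_right Nat.two_pos h))]

theorem headerEntry_lt {ℓ s w : ℕ} (hw : memSize ℓ s < 2 ^ w) (a : ℕ) :
    headerEntry ℓ s a < 2 ^ w := by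
  have hsize := leafBase_le_memSize ℓ s
  have hbig := add_le_leafBase ℓ s
  have hcount : leafCount ℓ ≤ leafCount ℓ * 2 ^ s := Nat.le_mul_of_pos_right _ (by positivity)
  have hcount' : leafCount ℓ * 2 ^ s ≤ memSize ℓ s := Nat.le_add_left _ _
  have hNF : 2 ^ ℓ * 2 ^ s ≤ (ℓ + 1) * 2 ^ ℓ * 2 ^ s := by
    rw [mul_assoc]
    exact Nat.le_mul_of_pos_left _ (Nat.succ_pos ℓ)
  have hN : 2 ^ ℓ ≤ 2 ^ ℓ * 2 ^ s := Nat.le_mul_of_pos_right _ (by positivity)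
  have hF : 2 ^ s ≤ 2 ^ ℓ * 2 ^ s := Nat.le_mul_of_pos_left _ (by positivity)
  have hl : ℓ < 2 ^ ℓ := Nat.lt_two_pow_self
  have hs : s < 2 ^ s := Nat.lt_two_pow_self
  unfold headerEntry
  split <;> omega

/-- Division with remainder inverts the mixed-radix addresses. By `hkey` and `hb` the table entries
fit in a word. -/
theorem represents_of_eq_tableRep {w ℓ s b : ℕ} (hw : memSize ℓ s < 2 ^ w) (hb : b ≤ w)
    (hkey : ∀ m < ℓ, 2 ^ m * s ≤ w) (h : UniversalTables s ℓ) (r : LeafTables s b ℓ)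
    (M : ℕ → BitVec w) (hM : ∀ a < memSize ℓ s, M a = tableRep w h r a) :
    Represents M h r := by
  have hsize := leafBase_le_memSize ℓ s
  have h7 : 7 ≤ leafBase ℓ s := Nat.le_add_right _ _
  have hhead : ∀ a < 7, (M a).toNat = headerEntry ℓ s a := by
    intro a ha
    rw [hM a (by omega), tableRep, if_pos ha, BitVec.toNat_ofNat,
      Nat.mod_eq_of_lt (headerEntry_lt hw a)]
  refine ⟨hhead 0 (by omega), hhead 1 (by omega), hhead 2 (by omega), hhead 3 (by omega),
    hhead 4 (by omega), hhead 5 (by omega), hhead 6 (by omega), ?_, ?_⟩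
  · intro m i ch j
    have hpow : 2 ^ ((m : ℕ) + 1) ≤ 2 ^ ℓ := Nat.pow_le_pow_right Nat.two_pos m.isLt
    have hi : (i : ℕ) < 2 ^ ℓ := i.isLt.trans_le hpow
    have hj : (j : ℕ) < 12 * 2 ^ ℓ := j.isLt.trans_le (Nat.mul_le_mul_left _ hpow)
    have haddr := univAddr_lt_leafBase (lev := m + 1) m.isLt hi ch.isLt hj
    have hge : ¬ univAddr ℓ s (m + 1) i ch.toNat j < 7 := by
      rw [univAddr]
      omega
    rw [hM _ (by omega), tableRep, if_neg hge, if_pos haddr, univAddr, Nat.add_sub_cancel_left,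
      mul_add_div_of_lt hj, mul_add_mod_of_lt_right hj, mul_add_div_of_lt ch.isLt,
      mul_add_mod_of_lt_right ch.isLt, mul_add_div_of_lt hi, mul_add_mod_of_lt_right hi]
    simp only [univEntry, m.isLt, i.isLt, j.isLt, dif_pos, Fin.eta, BitVec.ofNat_toNat,
      BitVec.setWidth_eq]
    exact toNat_setWidth_of_le _ (hkey m m.isLt)
  · intro q hq ch
    have haddr := leafAddr_lt_memSize hq ch.isLt
    rw [hM _ haddr, tableRep, if_neg (by omega), if_neg (by omega), Nat.add_sub_cancel_left,
      mul_add_div_of_lt ch.isLt, mul_add_mod_of_lt_right ch.isLt, BitVec.ofNat_toNat,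
      BitVec.setWidth_eq]
    exact toNat_setWidth_of_le _ hb

/-- The number of steps of a query. -/
def queryTime (ℓ : ℕ) : ℕ := 200 * (leafCount ℓ * ((ℓ + 1) * 2 ^ ℓ))

/-- The padded key width may exceed `w`, but the value of a key is below `u ≤ 2 ^ w`, so it passes
unchanged through both conversions. -/
theorem evaluates_tabHash {u c b w : ℕ} (hu : u ≤ 2 ^ w) (hb : b ≤ w)
    (hw : memSize (depth c) (charBits u c) < 2 ^ w)
    (hkey : ∀ m < depth c, 2 ^ m * charBits u c ≤ w)
    (h : UniversalTables (charBits u c) (depth c))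
    (r : LeafTables (charBits u c) b (depth c)) :
    Evaluates queryProgram w (memSize (depth c) (charBits u c)) (queryTime (depth c))
      (tabHash h r) := by
  refine ⟨_, tableRep w h r, le_rfl, fun x σ hx hσ => ?_⟩
  have hM := represents_of_eq_tableRep hw hb hkey h r σ.mem hσ
  have hreg : (σ.reg 0).toNat = (BitVec.ofNat (2 ^ depth c * charBits u c) (x : ℕ)).toNat := by
    rw [hx, BitVec.toNat_ofNat, BitVec.toNat_ofNat, Nat.mod_eq_of_lt (x.isLt.trans_le hu),
      Nat.mod_eq_of_lt (x.isLt.trans_le le_two_pow_keyBits)]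
  obtain ⟨t, σ', hE, ht, hmem, hout⟩ := queryProgram_runs hw hM _ σ rfl hreg
  refine ⟨t, σ', hE, ht, ?_, fun a ha => by rw [hmem, hσ a ha]⟩
  apply BitVec.eq_of_toNat_eq
  rw [hout, toNat_setWidth_of_le _ hb]
  rfl

/-! ### Estimates -/

theorem pow_le_two_rpow {x e : ℝ} (hx : 0 ≤ x) (h : x ≤ 2 ^ e) (k : ℕ) :
    x ^ k ≤ (2 : ℝ) ^ (e * k) := by
  rw [Real.rpow_mul_natCast zero_le_two]
  exact pow_le_pow_left₀ hx h k

theorem two_pow_eq_rpow (k : ℕ) : (2 : ℝ) ^ k = (2 : ℝ) ^ (k : ℝ) := (Real.rpow_natCast 2 k).symm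

/-- In units of `s * n * a`, the exponents are `1` for the characters, `13 / 26` for the powers of
`a`, at most `1 / 4` for the output positions, and `-3` for the probability. The sum is `-5 / 4`,
and `n * a ≥ 4` turns it into `-5 * s`. The `s / 26` accounts for the at most `K` values of `a`. -/
theorem failureBound_le {n s t K : ℕ} {L : ℝ} (hn : 2 ≤ n) (ht : 2 * t = n * s)
    (hK : (K : ℝ) ≤ 2 ^ ((s : ℝ) / 26)) (hnL : (n : ℝ) ≤ 2 ^ (L + 2))
    (hs : 24 * (6 + L) ≤ s) :
    failureBound n s (12 * n) t K ≤ 2 ^ ((s : ℝ) / 26 + (L + 2 - 5 * s)) := by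
  have hterm : ∀ a ∈ Finset.Icc 2 K,
      ((n * (2 ^ s) ^ (n * a) * a ^ (n * a) * (12 * n) ^ (12 * a) * a ^ (12 * n * a) : ℕ) : ℝ) /
        ((2 : ℝ) ^ t) ^ (6 * a) ≤ 2 ^ (L + 2 - 5 * s) := by
    intro a ha
    obtain ⟨ha2, haK⟩ := Finset.mem_Icc.mp ha
    have haK' : (a : ℝ) ≤ 2 ^ ((s : ℝ) / 26) := (Nat.cast_le.mpr haK).trans hK
    have h12 : (12 * n : ℝ) ≤ 2 ^ (6 + L) := by
      have h16 : (2 : ℝ) ^ (6 + L) = 16 * 2 ^ (L + 2) := by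
        rw [show 6 + L = (4 : ℕ) + (L + 2) by push_cast; ring, Real.rpow_add two_pos,
          Real.rpow_natCast]
        norm_num
      rw [h16]
      have : (0 : ℝ) ≤ n := Nat.cast_nonneg n
      nlinarith
    have e1 : ((2 : ℝ) ^ s) ^ (n * a) ≤ 2 ^ ((s : ℝ) * (n * a : ℕ)) :=
      pow_le_two_rpow (by positivity) (two_pow_eq_rpow s).le _
    have e2 := pow_le_two_rpow (Nat.cast_nonneg a) haK' (n * a)
    have e3 := pow_le_two_rpow (by positivity) h12 (12 * a)
    have e4 := pow_le_two_rpow (Nat.cast_nonneg a) haK' (12 * n * a)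
    have e5 : ((2 : ℝ) ^ t) ^ (6 * a) = 2 ^ ((t : ℝ) * (6 * a : ℕ)) := by
      rw [two_pow_eq_rpow, Real.rpow_mul_natCast zero_le_two]
    rw [e5, div_le_iff₀ (by positivity), ← Real.rpow_add two_pos]
    push_cast
    calc (n : ℝ) * (2 ^ s) ^ (n * a) * a ^ (n * a) * (12 * n) ^ (12 * a) * a ^ (12 * n * a)
        ≤ 2 ^ (L + 2) * 2 ^ ((s : ℝ) * (n * a : ℕ)) * 2 ^ ((s : ℝ) / 26 * (n * a : ℕ)) *
            2 ^ ((6 + L) * (12 * a : ℕ)) * 2 ^ ((s : ℝ) / 26 * (12 * n * a : ℕ)) := by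
          gcongr
      _ ≤ _ := by
          rw [← Real.rpow_add two_pos, ← Real.rpow_add two_pos, ← Real.rpow_add two_pos,
            ← Real.rpow_add two_pos]
          apply Real.rpow_le_rpow_of_exponent_le one_le_two
          push_cast
          have ht' : (2 : ℝ) * t = n * s := by exact_mod_cast ht
          have hn' : (2 : ℝ) ≤ n := by exact_mod_cast hn
          have ha' : (2 : ℝ) ≤ a := by exact_mod_cast ha2
          have hs0 : (0 : ℝ) ≤ s := Nat.cast_nonneg s
          have hta : 6 * (t : ℝ) * a = 3 * (s * (n * a)) := by
            linear_combination (3 * a : ℝ) * ht'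
          have hLa : (6 + L) * (12 * a) ≤ s * (n * a) / 4 := by
            have h1 : (6 + L) * (12 * a) ≤ s / 2 * a := by nlinarith
            have h2 : (s : ℝ) / 2 * a ≤ s * (n * a) / 4 := by
              have : 0 ≤ (s : ℝ) * a * (n - 2) :=
                mul_nonneg (mul_nonneg hs0 (by linarith)) (by linarith)
              linarith
            exact h1.trans h2
          have hna : (4 : ℝ) ≤ n * a := by nlinarith
          have hsna : s * 4 ≤ s * (n * a : ℝ) := mul_le_mul_of_nonneg_left hna hs0
          linarith
  calc failureBound n s (12 * n) t K
      ≤ ∑ a ∈ Finset.Icc 2 K, (2 : ℝ) ^ (L + 2 - 5 * s) := Finset.sum_le_sum hterm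
    _ = ((Finset.Icc 2 K).card : ℝ) * 2 ^ (L + 2 - 5 * s) := by
        rw [Finset.sum_const, nsmul_eq_mul]
    _ ≤ 2 ^ ((s : ℝ) / 26) * 2 ^ (L + 2 - 5 * s) := by
        gcongr
        refine le_trans ?_ hK
        rw [Nat.card_Icc]
        exact_mod_cast (by omega : K + 1 - 2 ≤ K)
    _ = _ := (Real.rpow_add two_pos _ _).symm

/-- From `12 * 2 ^ i ≤ 2 ^ (i + 4)` by summing the exponents. -/
theorem leafCount_le : ∀ ℓ : ℕ, (leafCount ℓ : ℝ) ≤ 2 ^ (((ℓ : ℝ) ^ 2 + 9 * ℓ) / 2)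
  | 0 => by simp [leafCount]
  | m + 1 => by
      have h16 : (12 * 2 ^ (m + 1) : ℝ) ≤ 2 ^ ((m : ℝ) + 5) := by
        have : (2 : ℝ) ^ ((m : ℝ) + 5) = 2 ^ (m + 5) := by
          rw [two_pow_eq_rpow (m + 5)]
          push_cast
          rfl
        rw [this, pow_succ, show m + 5 = m + 1 + 4 by rfl, pow_add _ (m + 1), pow_succ]
        have : (0 : ℝ) < 2 ^ m := by positivity
        linarith
      rw [leafCount]
      push_cast
      calc (leafCount m : ℝ) * (12 * 2 ^ (m + 1))
          ≤ 2 ^ (((m : ℝ) ^ 2 + 9 * m) / 2) * 2 ^ ((m : ℝ) + 5) := by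
            gcongr
            exact leafCount_le m
        _ = _ := by
            rw [← Real.rpow_add two_pos]
            congr 1
            ring

/-- A common bound for the query time and for the space per input character. -/
def costBound (ℓ : ℕ) : ℕ := 2 ^ 8 * 2 ^ (3 * ℓ) * leafCount ℓ

theorem queryTime_le (ℓ : ℕ) : queryTime ℓ ≤ costBound ℓ := by
  have h1 : ℓ + 1 ≤ 2 ^ ℓ := Nat.lt_two_pow_self
  have h2 : (ℓ + 1) * 2 ^ ℓ ≤ 2 ^ (3 * ℓ) := by
    calc (ℓ + 1) * 2 ^ ℓ ≤ 2 ^ ℓ * 2 ^ ℓ := Nat.mul_le_mul_right _ h1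
      _ = 2 ^ (2 * ℓ) := by rw [← pow_add, two_mul]
      _ ≤ 2 ^ (3 * ℓ) := Nat.pow_le_pow_right Nat.two_pos (by omega)
  calc queryTime ℓ = 200 * ((ℓ + 1) * 2 ^ ℓ) * leafCount ℓ := by rw [queryTime]; ring
    _ ≤ 2 ^ 8 * 2 ^ (3 * ℓ) * leafCount ℓ :=
        Nat.mul_le_mul_right _ (Nat.mul_le_mul (by norm_num) h2)

theorem memSize_le (ℓ s : ℕ) : memSize ℓ s ≤ costBound ℓ * 2 ^ s := by
  have h1 : ℓ + 1 ≤ 2 ^ ℓ := Nat.lt_two_pow_self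
  have hD := leafCount_pos ℓ
  have hs : 1 ≤ 2 ^ s := Nat.one_le_two_pow
  have h3 : 1 ≤ 2 ^ (3 * ℓ) := Nat.one_le_two_pow
  have h2 : (ℓ + 1) * 2 ^ ℓ * 2 ^ s * (12 * 2 ^ ℓ) ≤ 12 * 2 ^ (3 * ℓ) * 2 ^ s := by
    calc (ℓ + 1) * 2 ^ ℓ * 2 ^ s * (12 * 2 ^ ℓ)
        ≤ 2 ^ ℓ * 2 ^ ℓ * 2 ^ s * (12 * 2 ^ ℓ) := by gcongr
      _ = _ := by ring
  rw [memSize, leafBase, costBound]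
  set A := 2 ^ (3 * ℓ)
  set F := 2 ^ s
  set D := leafCount ℓ
  have hAF : 1 ≤ A * F := Nat.mul_pos h3 hs
  have hADF : A * F ≤ A * F * D := Nat.le_mul_of_pos_right _ hD
  have hDF : D * F ≤ A * (D * F) := Nat.le_mul_of_pos_left _ h3
  have e1 : A * (D * F) = A * F * D := by ring
  have e2 : 2 ^ 8 * A * D * F = 256 * (A * F * D) := by ring
  have e3 : 12 * A * F = 12 * (A * F) := by ring
  omega

/-- The leading exponent is only `L ^ 2 / 2`; `24 ≤ L` lets the other half of `L ^ 2` absorb the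
linear terms and the extra `-L`, which later becomes the factor `1 / c` behind every little-o. -/
theorem costBound_le {ℓ : ℕ} {L : ℝ} (hL : 24 ≤ L) (hℓ : (ℓ : ℝ) ≤ L + 2) :
    (costBound ℓ : ℝ) ≤ 2 ^ (L ^ 2 - L) := by
  have h1 : (costBound ℓ : ℝ) ≤ 2 ^ ((8 : ℝ) + 3 * ℓ + ((ℓ : ℝ) ^ 2 + 9 * ℓ) / 2) := by
    rw [costBound, Real.rpow_add two_pos, Real.rpow_add two_pos]
    push_cast
    have e1 : (2 : ℝ) ^ (8 : ℝ) = 2 ^ 8 := by exact_mod_cast Real.rpow_natCast 2 8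
    have e2 : (2 : ℝ) ^ (3 * (ℓ : ℝ)) = 2 ^ (3 * ℓ) := by
      exact_mod_cast Real.rpow_natCast 2 (3 * ℓ)
    rw [e1, e2]
    norm_num
    exact leafCount_le ℓ
  refine h1.trans (Real.rpow_le_rpow_of_exponent_le one_le_two ?_)
  have hℓ0 : (0 : ℝ) ≤ ℓ := Nat.cast_nonneg ℓ
  have h2 : (ℓ : ℝ) ^ 2 ≤ (L + 2) ^ 2 := pow_le_pow_left₀ hℓ0 hℓ 2
  nlinarith

/-! ### The parameters -/

/-- Consequences of `c ^ (c ^ 2) = u ^ ε` for large `c` and small `ε`. -/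
structure Admissible (u c : ℕ) : Prop where
  two_le_u : 2 ≤ u
  two_le_c : 2 ≤ c
  logb_ge : 24 ≤ Real.logb 2 c
  logb_le : Real.logb 2 c ≤ c
  ratio : 1000 * (c * Real.logb 2 c) ≤ Real.logb 2 u / c

theorem admissible_of_eq {u c : ℕ} {ε : ℝ} (hc : 2 ^ 24 ≤ c) (hε : ε ≤ 1 / 1000)
    (h : (c : ℝ) ^ (c ^ 2) = (u : ℝ) ^ ε) : Admissible u c := by
  have hc2 : 2 ≤ c := le_trans (by norm_num) hc
  have hc0 : (0 : ℝ) < c := by exact_mod_cast (by omega : 0 < c)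
  have hgt : 1 < (c : ℝ) ^ (c ^ 2) :=
    one_lt_pow₀ (by exact_mod_cast (by omega : 1 < c)) (by positivity)
  -- For `u ≤ 1` the right-hand side of `h` would be `0` or `1`, whatever `ε` is.
  have hu : 2 ≤ u := by
    by_contra hu
    rcases (by omega : u = 0 ∨ u = 1) with rfl | rfl
    · rw [h] at hgt
      rcases eq_or_ne ε 0 with rfl | hε0
      · simp at hgt
      · rw [Nat.cast_zero, Real.zero_rpow hε0] at hgt
        linarith
    · rw [h] at hgt
      simp at hgt
  have hu0 : (0 : ℝ) < u := by exact_mod_cast (by omega : 0 < u)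
  have hlog := congrArg (Real.logb 2) h
  rw [Real.logb_pow, Real.logb_rpow_eq_mul_logb_of_pos hu0] at hlog
  have hU : 0 ≤ Real.logb 2 u :=
    Real.logb_nonneg one_lt_two (by exact_mod_cast (by omega : 1 ≤ u))
  have hlb : 24 ≤ Real.logb 2 c := by
    rw [Real.le_logb_iff_rpow_le one_lt_two hc0]
    have : (2 : ℝ) ^ (24 : ℝ) = 2 ^ 24 := by exact_mod_cast Real.rpow_natCast 2 24
    rw [this]
    exact_mod_cast hc
  refine ⟨hu, hc2, hlb, ?_, ?_⟩
  · rw [Real.logb_le_iff_le_rpow one_lt_two hc0, Real.rpow_natCast]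
    exact_mod_cast Nat.lt_two_pow_self.le
  · rw [le_div_iff₀ hc0]
    have : ε * Real.logb 2 u ≤ 1 / 1000 * Real.logb 2 u := mul_le_mul_of_nonneg_right hε hU
    push_cast at hlog
    nlinarith

namespace Admissible

variable {u c : ℕ}

theorem cast_c_pos (A : Admissible u c) : (0 : ℝ) < c := by
  have := A.two_le_c
  exact_mod_cast (by omega : 0 < c)

theorem cast_u_pos (A : Admissible u c) : (0 : ℝ) < u := by
  have := A.two_le_u
  exact_mod_cast (by omega : 0 < u)

theorem ratio_ge (A : Admissible u c) : 24000 * (c : ℝ) ≤ Real.logb 2 u / c := by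
  have := A.ratio
  have := A.logb_ge
  have := A.cast_c_pos
  nlinarith

theorem rpow_eq (A : Admissible u c) (z : ℝ) :
    (u : ℝ) ^ (z / (c : ℝ)) = 2 ^ (z * (Real.logb 2 u / c)) := by
  rw [show z * (Real.logb 2 u / c) = Real.logb 2 u * (z / c) by ring, Real.rpow_mul zero_le_two,
    Real.rpow_logb two_pos (by norm_num) A.cast_u_pos]

theorem c_eq (A : Admissible u c) : (2 : ℝ) ^ Real.logb 2 c = c :=
  Real.rpow_logb two_pos (by norm_num) A.cast_c_pos

theorem two_pow_depth_le (A : Admissible u c) : 2 ^ depth c ≤ 4 * c := by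
  have h := Nat.pow_pred_clog_lt_self Nat.one_lt_two (show 1 < c from A.two_le_c)
  have hpos : 0 < Nat.clog 2 c := Nat.clog_pos Nat.one_lt_two A.two_le_c
  have h2 : 2 ^ depth c = 4 * 2 ^ (Nat.clog 2 c).pred := by
    rw [depth, show Nat.clog 2 c + 1 = (Nat.clog 2 c).pred + 2 by rw [Nat.pred_eq_sub_one]; omega,
      pow_add]
    ring
  omega

theorem le_two_pow_depth : 2 * c ≤ 2 ^ depth c := by
  have h := Nat.le_pow_clog Nat.one_lt_two c
  rw [depth, pow_succ]
  omega

theorem two_pow_depth_le_rpow (A : Admissible u c) :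
    (2 : ℝ) ^ depth c ≤ 2 ^ (Real.logb 2 c + 2) := by
  have h : (2 : ℝ) ^ depth c ≤ 4 * c := by exact_mod_cast A.two_pow_depth_le
  rw [Real.rpow_add two_pos, A.c_eq]
  norm_num
  linarith

theorem depth_le (A : Admissible u c) : (depth c : ℝ) ≤ Real.logb 2 c + 2 := by
  have h := A.two_pow_depth_le_rpow
  rw [two_pow_eq_rpow] at h
  exact (Real.rpow_le_rpow_left_iff one_lt_two).mp h

theorem logb_le_clog (A : Admissible u c) : Real.logb 2 u ≤ Nat.clog 2 u := by
  rw [Real.logb_le_iff_le_rpow one_lt_two A.cast_u_pos, Real.rpow_natCast]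
  exact_mod_cast Nat.le_pow_clog Nat.one_lt_two u

theorem clog_le (A : Admissible u c) : (Nat.clog 2 u : ℝ) ≤ Real.logb 2 u + 1 := by
  have h := Nat.pow_pred_clog_lt_self Nat.one_lt_two (show 1 < u from A.two_le_u)
  have hpos : 0 < Nat.clog 2 u := Nat.clog_pos Nat.one_lt_two A.two_le_u
  have h1 : ((Nat.clog 2 u).pred : ℝ) ≤ Real.logb 2 u := by
    rw [Real.le_logb_iff_rpow_le one_lt_two A.cast_u_pos, Real.rpow_natCast]
    exact_mod_cast h.le
  have h2 : (Nat.clog 2 u : ℝ) = (Nat.clog 2 u).pred + 1 := by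
    exact_mod_cast (Nat.succ_pred_eq_of_pos hpos).symm
  linarith

theorem clog_le_mul : Nat.clog 2 u ≤ 2 ^ depth c * charBits u c :=
  le_smul_ceilDiv (by positivity : 0 < 2 ^ depth c)

theorem mul_charBits_le : 2 ^ depth c * charBits u c ≤ Nat.clog 2 u + 2 ^ depth c := by
  have hpos : 0 < 2 ^ depth c := by positivity
  rw [charBits, Nat.ceilDiv_eq_add_pred_div]
  have := Nat.mul_div_le (Nat.clog 2 u + 2 ^ depth c - 1) (2 ^ depth c)
  omega

/-- Characters are long enough for the independence, as `c' ≤ 4 * c`. -/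
theorem ratio_le_charBits (A : Admissible u c) : Real.logb 2 u / c ≤ 4 * charBits u c := by
  rw [div_le_iff₀ A.cast_c_pos]
  have h1 : (Nat.clog 2 u : ℝ) ≤ 2 ^ depth c * charBits u c := by
    exact_mod_cast clog_le_mul (u := u) (c := c)
  have h2 : (2 : ℝ) ^ depth c ≤ 4 * c := by exact_mod_cast A.two_pow_depth_le
  have h3 : (2 : ℝ) ^ depth c * charBits u c ≤ 4 * c * charBits u c :=
    mul_le_mul_of_nonneg_right h2 (Nat.cast_nonneg _)
  have := A.logb_le_clog
  linarith

/-- Characters are short enough for the space, as `c' ≥ 2 * c`: up to a constant, `2 ^ s` is at most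
the square root of `u ^ (1 / c)`. -/
theorem charBits_le (A : Admissible u c) : (charBits u c : ℝ) ≤ Real.logb 2 u / c / 2 + 2 := by
  have hc := A.cast_c_pos
  have h1 : (2 : ℝ) ^ depth c * charBits u c ≤ Nat.clog 2 u + 2 ^ depth c := by
    exact_mod_cast mul_charBits_le (u := u) (c := c)
  have h2 : 2 * (c : ℝ) ≤ (2 : ℝ) ^ depth c := by exact_mod_cast le_two_pow_depth (c := c)
  have h3 := A.clog_le
  by_contra hlt
  push Not at hlt
  have h5 : Real.logb 2 u / c * c = Real.logb 2 u := div_mul_cancel₀ _ hc.ne'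
  have hY : 0 ≤ Real.logb 2 u / c := le_trans (by positivity) A.ratio_ge
  have h4 : 2 * (c : ℝ) * (charBits u c - 1) ≤ 2 ^ depth c * (charBits u c - 1) :=
    mul_le_mul_of_nonneg_right h2 (by linarith)
  have hc2 : (2 : ℝ) ≤ c := by exact_mod_cast A.two_le_c
  nlinarith

/-- Below the top level a key has at most half of the `c' * s ≤ ⌈lg u⌉ + c'` bits. Since `c' ≤ ⌈lg
u⌉`, the padding does no harm. -/
theorem two_pow_mul_charBits_le (A : Admissible u c) {w m : ℕ} (hu : u ≤ 2 ^ w)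
    (hm : m < depth c) :
    2 ^ m * charBits u c ≤ w := by
  have h1 : Nat.clog 2 u ≤ w := Nat.clog_le_of_le_pow hu
  have h2 := mul_charBits_le (u := u) (c := c)
  have h3 : 2 ^ depth c ≤ Nat.clog 2 u := by
    have h4 : (4 * c : ℝ) ≤ Nat.clog 2 u := by
      have hr := A.ratio_ge
      rw [le_div_iff₀ A.cast_c_pos] at hr
      have hc2 : (2 : ℝ) ≤ c := by exact_mod_cast A.two_le_c
      have := A.logb_le_clog
      nlinarith
    have h5 : 4 * c ≤ Nat.clog 2 u := by exact_mod_cast h4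
    exact A.two_pow_depth_le.trans h5
  have h6 : 2 ^ m * 2 ≤ 2 ^ depth c := by
    rw [← pow_succ]
    exact Nat.pow_le_pow_right Nat.two_pos hm
  have h7 : 2 ^ m * 2 * charBits u c ≤ 2 ^ depth c * charBits u c := Nat.mul_le_mul_right _ h6
  have h8 : 2 ^ m * 2 * charBits u c = 2 * (2 ^ m * charBits u c) := by ring
  omega

/-! ### Time, space and failure probability for admissible parameters -/

theorem queryTime_le_rpow (A : Admissible u c) :
    (queryTime (depth c) : ℝ) ≤ 1 / (c : ℝ) * (c : ℝ) ^ Real.logb 2 (c : ℝ) := by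
  have h1 : (queryTime (depth c) : ℝ) ≤ costBound (depth c) := by
    exact_mod_cast queryTime_le (depth c)
  refine (h1.trans (costBound_le A.logb_ge A.depth_le)).trans_eq ?_
  nth_rw 4 [← A.c_eq]
  nth_rw 3 [← A.c_eq]
  rw [← Real.rpow_mul zero_le_two, one_div, ← Real.rpow_neg zero_le_two, ← Real.rpow_add two_pos]
  congr 1
  ring

theorem memSize_le_rpow (A : Admissible u c) : (memSize (depth c) (charBits u c) : ℝ) ≤
    1 / (c : ℝ) * (u : ℝ) ^ (1 / (c : ℝ)) := by
  have h1 : (memSize (depth c) (charBits u c) : ℝ) ≤ costBound (depth c) * 2 ^ charBits u c := by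
    exact_mod_cast memSize_le (depth c) (charBits u c)
  refine h1.trans ((mul_le_mul_of_nonneg_right (costBound_le A.logb_ge A.depth_le)
    (by positivity)).trans ?_)
  have hinv : 1 / (c : ℝ) = 2 ^ (-Real.logb 2 c) := by
    rw [Real.rpow_neg zero_le_two, A.c_eq, one_div]
  rw [A.rpow_eq, hinv, two_pow_eq_rpow, ← Real.rpow_add two_pos, ← Real.rpow_add two_pos]
  -- The exponent `L ^ 2` of the cost is negligible against the unused half of `lg u / c`, by
  -- `ratio` and `logb_le`.
  apply Real.rpow_le_rpow_of_exponent_le one_le_two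
  have h2 := A.charBits_le
  have h3 := A.ratio
  have h4 := A.logb_le
  have h5 := A.logb_ge
  nlinarith

theorem memSize_lt (A : Admissible u c) {w : ℕ} (hu : u ≤ 2 ^ w) :
    memSize (depth c) (charBits u c) < 2 ^ w := by
  have hc1 : (1 : ℝ) < c := by
    have := A.two_le_c
    exact_mod_cast (by omega : 1 < c)
  have hu1 : (1 : ℝ) ≤ u := by
    have := A.two_le_u
    exact_mod_cast (by omega : 1 ≤ u)
  have hc : 1 / (c : ℝ) < 1 := (div_lt_one A.cast_c_pos).mpr hc1
  have h1 : (u : ℝ) ^ (1 / (c : ℝ)) ≤ u := by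
    simpa using Real.rpow_le_rpow_of_exponent_le hu1 hc.le
  have h2 : (memSize (depth c) (charBits u c) : ℝ) < u := by
    have hpos : 0 < (u : ℝ) ^ (1 / (c : ℝ)) := Real.rpow_pos_of_pos A.cast_u_pos _
    have := A.memSize_le_rpow
    nlinarith
  exact lt_of_lt_of_le (by exact_mod_cast h2) hu

/-- With high probability over the universal tables, the hash family is highly independent. -/
theorem unif_real_not_good_le (A : Admissible u c) (b : ℕ) :
    (unif (UniversalTables (charBits u c) (depth c))).real
      {h | ¬ ∀ k : ℕ, (k : ℝ) ≤ (u : ℝ) ^ ((1 / 104 : ℝ) / (c : ℝ)) → Good b k h} ≤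
      1 / (c : ℝ) * (1 / (u : ℝ) ^ (1 / (c : ℝ))) := by
  set L := Real.logb 2 (c : ℝ) with hLdef
  set s := charBits u c with hsdef
  set K := ⌊(u : ℝ) ^ ((1 / 104 : ℝ) / (c : ℝ))⌋₊ with hK
  have hL := A.logb_ge
  have hY := A.ratio_le_charBits
  have hs : 1000 * (c * L) ≤ 4 * s := A.ratio.trans hY
  have hc2 : (2 : ℝ) ≤ c := by exact_mod_cast A.two_le_c
  have hsL : 500 * L ≤ s := by nlinarith
  have hu1 : (1 : ℝ) ≤ u := by
    have := A.two_le_u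
    exact_mod_cast (by omega : 1 ≤ u)
  have hK1 : 1 ≤ K := by
    rw [hK, Nat.one_le_floor_iff]
    exact Real.one_le_rpow hu1 (by positivity)
  -- Here `κ = 1 / 104` is used: `104 = 4 * 26`, and `lg u / c ≤ 4 * s`.
  have hKs : (K : ℝ) ≤ 2 ^ ((s : ℝ) / 26) := by
    refine (Nat.floor_le (by positivity)).trans ?_
    rw [A.rpow_eq]
    apply Real.rpow_le_rpow_of_exponent_le one_le_two
    linarith
  have hsub : {h : UniversalTables s (depth c) |
      ¬ ∀ k : ℕ, (k : ℝ) ≤ (u : ℝ) ^ ((1 / 104 : ℝ) / (c : ℝ)) → Good b k h} ⊆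
      {h | ¬ ∀ m, UniqueOutputs K (h m)} := by
    intro h hh hU
    exact hh fun k hk => good_of_uniqueOutputs (Nat.le_floor hk) hK1 h hU
  have : IsProbabilityMeasure (unif (UniversalTables s (depth c))) := isProbabilityMeasure_unif
  refine (measureReal_mono hsub (measure_ne_top _ _)).trans (unif_univ_real_le.trans ?_)
  have hlev : ∀ m : Fin (depth c), failureBound (2 ^ ((m : ℕ) + 1)) s (12 * 2 ^ ((m : ℕ) + 1))
      (2 ^ (m : ℕ) * s) K ≤ 2 ^ ((s : ℝ) / 26 + (L + 2 - 5 * s)) := by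
    intro m
    refine failureBound_le ?_ (by ring) hKs ?_ (by linarith)
    · exact Nat.le_self_pow (Nat.succ_ne_zero _) 2
    · refine le_trans ?_ A.two_pow_depth_le_rpow
      push_cast
      exact pow_le_pow_right₀ one_le_two m.isLt
  have hdepth : (depth c : ℝ) ≤ 2 ^ (L + 2) := by
    refine le_trans ?_ A.two_pow_depth_le_rpow
    exact_mod_cast Nat.lt_two_pow_self.le
  have hinv : 1 / (c : ℝ) = 2 ^ (-L) := by
    rw [Real.rpow_neg zero_le_two, A.c_eq, one_div]
  calc ∑ m : Fin (depth c), failureBound (2 ^ ((m : ℕ) + 1)) s (12 * 2 ^ ((m : ℕ) + 1))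
        (2 ^ (m : ℕ) * s) K
      ≤ ∑ _m : Fin (depth c), (2 : ℝ) ^ ((s : ℝ) / 26 + (L + 2 - 5 * s)) :=
        Finset.sum_le_sum fun m _ => hlev m
    _ = (depth c : ℝ) * 2 ^ ((s : ℝ) / 26 + (L + 2 - 5 * s)) := by simp
    _ ≤ 2 ^ (L + 2) * 2 ^ ((s : ℝ) / 26 + (L + 2 - 5 * s)) := by gcongr
    -- Of the `5 * s` in the exponent, `4 * s` covers `lg u / c`; the remainder `s - s / 26` covers
    -- `3 * L + 4` because `s ≥ 500 * L`.
    _ ≤ 2 ^ (-L) * 2 ^ (-(1 * (Real.logb 2 u / c))) := by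
        rw [← Real.rpow_add two_pos, ← Real.rpow_add two_pos]
        apply Real.rpow_le_rpow_of_exponent_le one_le_two
        linarith
    _ = 1 / (c : ℝ) * (1 / (u : ℝ) ^ (1 / (c : ℝ))) := by
        rw [A.rpow_eq, hinv, Real.rpow_neg zero_le_two (1 * _), one_div ((2 : ℝ) ^ _)]

end Admissible

/-! ### From explicit bounds to the asymptotic statement -/

theorem isLittleO_of_le_mul {ι : Type} {l : Filter ι} {f g δ : ι → ℝ}
    (hδ : Tendsto δ l (𝓝 0)) (h : ∀ᶠ n in l, 0 ≤ f n ∧ f n ≤ δ n * g n) : f =o[l] g := by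
  have h1 : (fun n => δ n * g n) =o[l] g := by
    simpa using ((isLittleO_one_iff ℝ).mpr hδ).mul_isBigO (isBigO_refl g l)
  refine IsBigO.trans_isLittleO (IsBigO.of_bound 1 ?_) h1
  filter_upwards [h] with n hn
  rw [Real.norm_of_nonneg hn.1, one_mul]
  exact hn.2.trans (le_abs_self _)

end RecTab

theorem theorem4 :
    ∃ (κ : ℝ) (P : Cmd), 0 < κ ∧
      ∀ (ι : Type) (l : Filter ι) (u c b w : ι → ℕ) (ε : ι → ℝ),
        Tendsto c l atTop →
        -- `c ^ (c ^ 2) = u ^ o(1)`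
        Tendsto ε l (𝓝 0) →
        (∀ᶠ n in l, ((c n : ℝ) ^ (c n ^ 2) = (u n : ℝ) ^ ε n)) →
        -- keys and hash values fit in a word
        (∀ᶠ n in l, u n ≤ 2 ^ w n ∧ b n ≤ w n) →
        -- independence `u ^ Ω(1 / c)` with universal probability `1 - o(1 / u ^ (1 / c))`
        ((fun n => (unif (UniversalTables (charBits (u n) (c n)) (depth (c n)))).real
            {h | ¬ ∀ k : ℕ, (k : ℝ) ≤ (u n : ℝ) ^ (κ / (c n : ℝ)) → Good (b n) k h})
          =o[l] fun n => 1 / (u n : ℝ) ^ (1 / (c n : ℝ))) ∧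
        -- space `o(u ^ (1 / c))` and evaluation time `o(c ^ lg c)`
        ∃ S T : ι → ℕ,
          ((fun n => (S n : ℝ)) =o[l] fun n => (u n : ℝ) ^ (1 / (c n : ℝ))) ∧
          ((fun n => (T n : ℝ)) =o[l] fun n => (c n : ℝ) ^ Real.logb 2 (c n : ℝ)) ∧
          ∀ᶠ n in l, ∀ (h : UniversalTables (charBits (u n) (c n)) (depth (c n)))
            (r : LeafTables (charBits (u n) (c n)) (b n) (depth (c n))),
            Evaluates P (w n) (S n) (T n) (tabHash h r) := by
  refine ⟨1 / 104, queryProgram, by norm_num, ?_⟩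
  intro ι l u c b w ε hc hε heq hw
  have hadm : ∀ᶠ n in l, Admissible (u n) (c n) := by
    filter_upwards [hc.eventually_ge_atTop (2 ^ 24),
      hε.eventually_le_const (show (0 : ℝ) < 1 / 1000 by norm_num), heq] with n h1 h2 h3
    exact admissible_of_eq h1 h2 h3
  -- All three bounds carry the same vanishing factor `1 / c`.
  have hδ : Tendsto (fun n => 1 / (c n : ℝ)) l (𝓝 0) :=
    tendsto_one_div_atTop_nhds_zero_nat.comp hc
  refine ⟨isLittleO_of_le_mul hδ ?_, fun n => memSize (depth (c n)) (charBits (u n) (c n)),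
    fun n => queryTime (depth (c n)), isLittleO_of_le_mul hδ ?_, isLittleO_of_le_mul hδ ?_, ?_⟩
  · filter_upwards [hadm] with n hn
    exact ⟨measureReal_nonneg, hn.unif_real_not_good_le (b n)⟩
  · filter_upwards [hadm] with n hn
    exact ⟨Nat.cast_nonneg _, hn.memSize_le_rpow⟩
  · filter_upwards [hadm] with n hn
    exact ⟨Nat.cast_nonneg _, hn.queryTime_le_rpow⟩
  · filter_upwards [hadm, hw] with n hn hwn h r
    exact evaluates_tabHash hwn.1 hwn.2 (hn.memSize_lt hwn.1)
      (fun m hm => hn.two_pow_mul_charBits_le hwn.1 hm) h r
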